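/- Setting. Let $d\ge 1$, let $\Omega\subset\mathbb R^d$ be a bounded domain (open and connected) with smooth boundary and outward unit normal $\nu$, and let $T>0$. Let $c:\mathbb R^d\to[c_0,\infty)$, $c_0>0$, and $F:\mathbb R^d\times\mathbb R\times\mathbb R\times\mathbb R^d\to\mathbb R$ be of class $C^1$. Let $(\Psi_n)_{n\ge1}$ be an orthonormal basis of $L^2(0,T)$ consisting of functions in $C^1([0,T])$ and let $N$ be a cut-off number. Put $S=(s_{mn})_{m,n=1}^N$ with $s_{mn}=\int_0^T\Psi_n'(t)\Psi_m(t)\,dt$, and ${\bf F}=(F_1,\dots,F_N)^{\rm T}$ with $$F_m({\bf x},U({\bf x}),\nabla U({\bf x}))=\int_0^T F\Big({\bf x},t,\sum_{n=1}^N u_n({\bf x})\Psi_n(t),\sum_{n=1}^N\nabla u_n({\bf x})\Psi_n(t)\Big)\Psi_m(t)\,dt ,\qquad U=(u_1,\dots,u_N)^{\rm T}.$$ Let ${\bf x}_0\in\mathbb R^d\setminus\overline\Omega$ be such that $r({\bf x})=|{\bf x}-{\bf x}_0|>1$ for all ${\bf x}\in\Omega$, let $b>\max_{\overline\Omega}r$,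 and let $\beta>0$ and $\lambda>0$ be arbitrary (in particular, $\beta=\beta_0$ and $\lambda>\lambda_0$ may be chosen such that the Carleman estimate with weight $e^{2\lambda b^{-\beta}r^{\beta}}$ holds for the functions in $H^2(\Omega)$ with vanishing Cauchy data). Let $G,Q:\partial\Omega\to\mathbb R^N$ be such that $$H=\{V\in H^2(\Omega)^N:\ V|_{\partial\Omega}=G,\ \partial_\nu V|_{\partial\Omega}=Q\}$$ (boundary values in the sense of traces) is nonempty. Given $U^{(k-1)}\in H^2(\Omega)^N$, define for $V\in H$ $$J^{(k)}(V)=\int_\Omega e^{2\lambda b^{-\beta}r^{\beta}({\bf x})}\Big|\Delta V-c({\bf x})SV+{\bf F}({\bf x},U^{(k-1)},\nabla U^{(k-1)})\Big|^2d{\bf x}.$$ Theorem. (i) For each $k\ge1$ and each $U^{(k-1)}\in H^2(\Omega)^N$ with ${\bf F}(\cdot,U^{(k-1)},\nabla U^{(k-1)})\in L^2(\Omega)^N$, the functional $J^{(k)}$ has a unique minimizer in $H$. (ii) Consequently, if $U^{(0)}\in H^2(\Omega)^N$ and ${\bf F}(\cdot,W,\nabla W)\in L^2(\Omega)^N$ for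 $W=U^{(0)}$ and for all $W\in H$ (for example, if $F$ is bounded), then there is exactly one sequence $(U^{(k)})_{k\ge0}$ in $H^2(\Omega)^N$ that starts at $U^{(0)}$ and in which, for every $k\ge1$, $U^{(k)}$ is a minimizer of $J^{(k)}$ in $H$. -/

import Mathlib

open MeasureTheory Set Filter Topology
open scoped ContDiff

noncomputable section

namespace CarlemanLS

/-- Euclidean space `ℝ^d`. -/
abbrev E (d : ℕ) := EuclideanSpace ℝ (Fin d)

/-- The real Hilbert space `L²(Ω)`. -/
abbrev L2 {d : ℕ} (Ω : Set (E d)) := Lp ℝ 2 (volume.restrict Ω)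

/-- The classical partial derivative `∂ᵢ φ (x)`. -/
def partialDeriv {d : ℕ} (i : Fin d) (φ : E d → ℝ) (x : E d) : ℝ :=
  fderiv ℝ φ x (EuclideanSpace.single i 1)

/-! ### Smooth domains -/

/-- `ρ` is a smooth local defining function of `Ω` at the boundary point `y`: near `y` the set `Ω`
is `{ρ < 0}`, and `∇ρ(y) ≠ 0`. -/
structure IsDefiningFunctionAt {d : ℕ} (Ω : Set (E d)) (y : E d) (ρ : E d → ℝ) : Prop where
  smooth : ContDiff ℝ ∞ ρ
  gradient_ne_zero : gradient ρ y ≠ 0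
  eventually_mem_iff : ∀ᶠ x in 𝓝 y, (x ∈ Ω ↔ ρ x < 0)

/-- The boundary of the open set `Ω` is a smooth hypersurface with `Ω` locally on one side. -/
def HasSmoothBoundary {d : ℕ} (Ω : Set (E d)) : Prop :=
  ∀ y ∈ frontier Ω, ∃ ρ : E d → ℝ, IsDefiningFunctionAt Ω y ρ

/-- `n` is the outward unit normal of `Ω` at `y`. -/
def IsOuterUnitNormal {d : ℕ} (Ω : Set (E d)) (y n : E d) : Prop :=
  ∃ ρ : E d → ℝ, IsDefiningFunctionAt Ω y ρ ∧ n = ‖gradient ρ y‖⁻¹ • gradient ρ y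

open Classical in
/-- The outward unit normal field `ν` on `∂Ω` (extended by `0`). -/
def outerNormal {d : ℕ} (Ω : Set (E d)) (y : E d) : E d :=
  if h : y ∈ frontier Ω ∧ ∃ n, IsOuterUnitNormal Ω y n then h.2.choose else 0

/-- The surface measure on `∂Ω`: the `(d-1)`-dimensional Hausdorff measure, normalized so as to
agree with Lebesgue measure on hyperplanes. -/
def surfaceMeasure {d : ℕ} (Ω : Set (E d)) : Measure (E d) :=
  (Measure.euclideanHausdorffMeasure (d - 1)).restrict (frontier Ω)

/-! ### The Sobolev space `H²(Ω)` -/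

/-- `w` is the weak partial derivative `∂ᵢ u` in `Ω`. -/
def HasWeakPartial {d : ℕ} (Ω : Set (E d)) (i : Fin d) (u w : E d → ℝ) : Prop :=
  ∀ φ : E d → ℝ, ContDiff ℝ ∞ φ → HasCompactSupport φ → tsupport φ ⊆ Ω →
    ∫ x in Ω, u x * partialDeriv i φ x = - ∫ x in Ω, w x * φ x

/-- The Sobolev space `H²(Ω)`: an `L²` function together with its weak partial derivatives of first
and second order, all in `L²(Ω)`. The weak derivatives are determined by the function. -/
@[ext]
structure H2 {d : ℕ} (Ω : Set (E d)) where
  /-- the function -/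
  val : L2 Ω
  /-- its weak partial derivatives `∂ᵢ` -/
  grad : Fin d → L2 Ω
  /-- its weak second partial derivatives `∂ⱼ ∂ᵢ` -/
  hess : Fin d → Fin d → L2 Ω
  weak_grad : ∀ i, HasWeakPartial Ω i val (grad i)
  weak_hess : ∀ i j, HasWeakPartial Ω j (grad i) (hess i j)

/-- The weak gradient as a vector field. -/
def H2.nabla {d : ℕ} {Ω : Set (E d)} (v : H2 Ω) (x : E d) : E d :=
  WithLp.toLp 2 (fun i => v.grad i x)

/-- The weak Laplacian `Δ v`. -/
def H2.laplacian {d : ℕ} {Ω : Set (E d)} (v : H2 Ω) (x : E d) : ℝ :=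
  ∑ i, v.hess i i x

/-- `v|_{∂Ω} = g` in the sense of traces: `g ∈ L²(∂Ω)` is the function for which the Gauss-Green
formula `∫_Ω (v ∂ᵢφ + (∂ᵢv) φ) = ∫_{∂Ω} g φ νᵢ dσ` holds for all smooth `φ` on `ℝ^d`. -/
def HasDirichletTrace {d : ℕ} {Ω : Set (E d)} (v : H2 Ω) (g : E d → ℝ) : Prop :=
  MemLp g 2 (surfaceMeasure Ω) ∧
    ∀ φ : E d → ℝ, ContDiff ℝ ∞ φ → ∀ i : Fin d,
      ∫ x in Ω, (v.val x * partialDeriv i φ x + v.grad i x * φ x) =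
        ∫ y, g y * φ y * outerNormal Ω y i ∂(surfaceMeasure Ω)

/-- `∂_ν v|_{∂Ω} = q` in the sense of traces: `q ∈ L²(∂Ω)` is the function for which Green's first
identity `∫_Ω ((Δv) φ + ∇v · ∇φ) = ∫_{∂Ω} q φ dσ` holds for all smooth `φ` on `ℝ^d`. -/
def HasNeumannTrace {d : ℕ} {Ω : Set (E d)} (v : H2 Ω) (q : E d → ℝ) : Prop :=
  MemLp q 2 (surfaceMeasure Ω) ∧
    ∀ φ : E d → ℝ, ContDiff ℝ ∞ φ →
      ∫ x in Ω, (v.laplacian x * φ x + ∑ i, v.grad i x * partialDeriv i φ x) =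
        ∫ y, q y * φ y ∂(surfaceMeasure Ω)

/-- The admissible set `H` of all `V ∈ H²(Ω)^N` with `V|_{∂Ω} = G` and `∂_ν V|_{∂Ω} = Q`. -/
def admissible {d N : ℕ} (Ω : Set (E d)) (G Q : Fin N → E d → ℝ) : Set (Fin N → H2 Ω) :=
  {V | ∀ m, HasDirichletTrace (V m) (G m) ∧ HasNeumannTrace (V m) (Q m)}

/-! ### The time basis and the reduced system -/

/-- `Ψ₀, Ψ₁, …` are `C¹` functions on `[0,T]` that form an orthonormal basis of `L²(0,T)`. -/
def IsC1OrthonormalBasis (T : ℝ) (Ψ : ℕ → ℝ → ℝ) : Prop :=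
  (∀ n, ContDiffOn ℝ 1 (Ψ n) (Icc 0 T)) ∧
    ∃ B : HilbertBasis ℕ ℝ (Lp ℝ 2 (volume.restrict (Ioo (0 : ℝ) T))),
      ∀ n, B n =ᵐ[volume.restrict (Ioo (0 : ℝ) T)] Ψ n

/-- The matrix `S = (s_{mn})`, `s_{mn} = ∫₀ᵀ Ψₙ'(t) Ψₘ(t) dt`. -/
def matS (N : ℕ) (T : ℝ) (Ψ : ℕ → ℝ → ℝ) : Matrix (Fin N) (Fin N) ℝ :=
  Matrix.of fun m n => ∫ t in (0 : ℝ)..T, deriv (Ψ n) t * Ψ m t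

/-- The reduced nonlinearity: `F_m(x, s, p)` is
`∫₀ᵀ F(x, t, ∑ₙ sₙ Ψₙ(t), ∑ₙ Ψₙ(t) pₙ) Ψₘ(t) dt`. -/
def reducedF {d N : ℕ} (T : ℝ) (Ψ : ℕ → ℝ → ℝ) (F : E d × ℝ × ℝ × E d → ℝ) (m : Fin N)
    (x : E d) (s : Fin N → ℝ) (p : Fin N → E d) : ℝ :=
  ∫ t in (0 : ℝ)..T, F (x, t, ∑ n : Fin N, s n * Ψ n t, ∑ n : Fin N, Ψ n t • p n) * Ψ m t

/-- The `m`-th component of `x ↦ 𝐅(x, W(x), ∇W(x))`. -/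
def source {d N : ℕ} {Ω : Set (E d)} (T : ℝ) (Ψ : ℕ → ℝ → ℝ) (F : E d × ℝ × ℝ × E d → ℝ)
    (W : Fin N → H2 Ω) (m : Fin N) (x : E d) : ℝ :=
  reducedF T Ψ F m x (fun n => (W n).val x) (fun n => (W n).nabla x)

/-- `𝐅(·, W, ∇W) ∈ L²(Ω)^N`. -/
def SourceMemL2 {d N : ℕ} {Ω : Set (E d)} (T : ℝ) (Ψ : ℕ → ℝ → ℝ) (F : E d × ℝ × ℝ × E d → ℝ)
    (W : Fin N → H2 Ω) : Prop :=
  ∀ m, MemLp (source T Ψ F W m) 2 (volume.restrict Ω)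

/-- The `m`-th component of `Δ V - c S V + 𝐅(x, W, ∇W)`. -/
def residual {d N : ℕ} {Ω : Set (E d)} (T : ℝ) (Ψ : ℕ → ℝ → ℝ) (c : E d → ℝ)
    (F : E d × ℝ × ℝ × E d → ℝ) (W V : Fin N → H2 Ω) (m : Fin N) (x : E d) : ℝ :=
  (V m).laplacian x - c x * (matS N T Ψ).mulVec (fun n => (V n).val x) m + source T Ψ F W m x

/-- The Carleman weight `exp(2 λ b^{-β} r(x)^β)`, with `r(x) = |x - x₀|`. -/
def carlemanWeight {d : ℕ} (x₀ : E d) (b β lam : ℝ) (x : E d) : ℝ :=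
  Real.exp (2 * lam * b ^ (-β) * ‖x - x₀‖ ^ β)

/-- The Carleman weighted least squares functional
`V ↦ ∫_Ω exp(2 λ b^{-β} r^β) |Δ V - c S V + 𝐅(x, W, ∇W)|² dx`, where `W` is the previous iterate. -/
def J {d N : ℕ} {Ω : Set (E d)} (T : ℝ) (Ψ : ℕ → ℝ → ℝ) (c : E d → ℝ)
    (F : E d × ℝ × ℝ × E d → ℝ) (x₀ : E d) (b β lam : ℝ) (W V : Fin N → H2 Ω) : ℝ :=
  ∫ x in Ω, carlemanWeight x₀ b β lam x * ∑ m, residual T Ψ c F W V m x ^ 2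

/-- `V` is a minimizer in `H` of the functional `J` built from the previous iterate `W`. -/
def IsMinimizer {d N : ℕ} {Ω : Set (E d)} (T : ℝ) (Ψ : ℕ → ℝ → ℝ) (c : E d → ℝ)
    (F : E d × ℝ × ℝ × E d → ℝ) (x₀ : E d) (b β lam : ℝ) (G Q : Fin N → E d → ℝ)
    (W V : Fin N → H2 Ω) : Prop :=
  V ∈ admissible Ω G Q ∧ IsMinOn (J T Ψ c F x₀ b β lam W) (admissible Ω G Q) V

end CarlemanLS

end

open CarlemanLS

/-!
Let `V`, `W` be admissible. Their difference `v` has vanishing Cauchy data, so that its extension by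
zero to `ℝ^d` has `∇v` and `Δv` (extended by zero) as weak gradient and Laplacian on the whole space.
Testing with complex exponentials, this is the statement that the Fourier-Laplace transform of `v`
satisfies `expInt_grad` and `expInt_lap`. Plancherel's theorem then gives three estimates:

* `‖∂ᵢ v‖² ≤ ‖v‖² + ‖Δv‖²` (`norm_grad_sq_le`);
* `‖∂ⱼ ∂ᵢ v‖ ≤ ‖Δv‖` (`norm_hess_le`);
* the Carleman estimate `2 τ ‖exp(τ xᵢ) v‖ ≤ R ‖exp(τ xᵢ) Δv‖` for every `τ > 0`, where `R` depends
  only on the diameter of `Ω` (`carleman_estimate`). Conjugating `Δ` with `exp(τ xᵢ)` gives a Fourier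
  multiplier whose imaginary part is `-4π τ ξᵢ`, and the derivative `∂ᵢ` of a function supported in
  `Ω` controls the function by comparison with a disjoint translate.

As `τ` is arbitrary, the zeroth order term `c S V` is absorbed, and so the linear part
`V ↦ √w (ΔV - c S V)` of the residual, where `w` is the weight of the functional, is bounded below in
the `H²` norm on the functions with vanishing Cauchy data (`exists_norm_le_weightedSysOp`). The
weight `w` enters only through being continuous and positive on the compact set `closure Ω`; it does
not serve as the Carleman weight of the argument.

The functional `J` is the squared norm of this operator plus a constant vector in `L²(Ω)^N`
(`J_eq_norm_sq`). The range of the operator on the closed space of differences of admissible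
functions is closed, and the minimizer is obtained by orthogonal projection onto it. Injectivity gives
uniqueness.
-/

open scoped FourierTransform SchwartzMap InnerProductSpace

/-! ### Plancherel's theorem for the Fourier integral -/

section Plancherel

variable {V : Type*} [NormedAddCommGroup V] [InnerProductSpace ℝ V] [FiniteDimensional ℝ V]
  [MeasurableSpace V] [BorelSpace V]

/-- On `L¹ ∩ L²` the Fourier transform on `L²`, defined by extension from Schwartz functions, is given
by the Fourier integral: both have the same pairing with every test function. -/
theorem coeFn_fourier_toLp_ae_eq {f : V → ℂ} (hf : Integrable f) (hf2 : MemLp f 2) :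
    (𝓕 (hf2.toLp f) : Lp ℂ 2 (volume : Measure V)) =ᵐ[volume] 𝓕 f := by
  have hc : Continuous (𝓕 f) :=
    VectorFourier.fourierIntegral_continuous Real.continuous_fourierChar
      (by exact continuous_inner) hf
  refine ae_eq_of_integral_contDiff_smul_eq ((Lp.memLp _).locallyIntegrable (by norm_num))
    hc.locallyIntegrable ?_
  intro g hg hgc
  have hg₁ : HasCompactSupport (Complex.ofRealCLM ∘ g) := hgc.comp_left rfl
  have hg₂ : ContDiff ℝ ∞ (Complex.ofRealCLM ∘ g) := by fun_prop
  set G := hg₁.toSchwartzMap hg₂ with hG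
  have h1 := congrArg (fun T => T G) (Lp.fourier_toTemperedDistribution_eq (hf2.toLp f))
  simp only [TemperedDistribution.fourier_apply, Lp.toTemperedDistribution_apply] at h1
  have h2 : ∫ x, (𝓕 G) x • (hf2.toLp f) x = ∫ x, (𝓕 G) x • f x :=
    integral_congr_ae (by filter_upwards [hf2.coeFn_toLp] with x hx; rw [hx])
  have h3 := VectorFourier.integral_fourierIntegral_smul_eq_flip (μ := volume) (ν := volume)
    (L := innerₗ V) (f := (G : V → ℂ)) (g := f) Real.continuous_fourierChar
    (by exact continuous_inner) G.integrable hf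
  rw [h2] at h1
  have h4 : ∀ h : V → ℂ, ∫ x, g x • h x = ∫ x, G x • h x := by
    intro h
    refine integral_congr_ae (.of_forall fun x => ?_)
    simp [hG]
  rw [h4, h4, ← h1, flip_innerₗ] at *
  exact h3

theorem memLp_fourier {f : V → ℂ} (hf : Integrable f) (hf2 : MemLp f 2) : MemLp (𝓕 f) 2 :=
  (memLp_congr_ae (coeFn_fourier_toLp_ae_eq hf hf2)).1 (Lp.memLp _)

theorem integral_inner_fourier_eq {f g : V → ℂ} (hf : Integrable f) (hf2 : MemLp f 2)
    (hg : Integrable g) (hg2 : MemLp g 2) :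
    ∫ ξ, ⟪𝓕 f ξ, 𝓕 g ξ⟫_ℂ = ∫ x, ⟪f x, g x⟫_ℂ := by
  have h := Lp.inner_fourier_eq (hf2.toLp f) (hg2.toLp g)
  rw [L2.inner_def, L2.inner_def] at h
  calc _ = _ := integral_congr_ae ?_
    _ = _ := h
    _ = _ := integral_congr_ae ?_
  · filter_upwards [coeFn_fourier_toLp_ae_eq hf hf2, coeFn_fourier_toLp_ae_eq hg hg2] with x h1 h2
    rw [h1, h2]
  · filter_upwards [hf2.coeFn_toLp, hg2.coeFn_toLp] with x h1 h2
    rw [h1, h2]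

theorem integral_norm_sq_fourier_eq {f : V → ℂ} (hf : Integrable f) (hf2 : MemLp f 2) :
    ∫ ξ, ‖𝓕 f ξ‖ ^ 2 = ∫ x, ‖f x‖ ^ 2 := by
  have h := integral_inner_fourier_eq hf hf2 hf hf2
  simp only [inner_self_eq_norm_sq_to_K] at h
  exact_mod_cast h

end Plancherel

noncomputable section

namespace CarlemanLS

/-! ### Pairings and multiplication operators on `L²(Ω)` -/

variable {d : ℕ} {Ω : Set (E d)}

theorem exists_bound_of_continuous (hΩ : Bornology.IsBounded Ω) {g : E d → ℝ}
    (hg : Continuous g) : ∃ C, 0 < C ∧ ∀ x ∈ Ω, |g x| ≤ C := by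
  obtain ⟨C, hC⟩ := hΩ.isCompact_closure.exists_bound_of_continuousOn hg.continuousOn
  exact ⟨max C 1, by positivity, fun x hx => (hC x (subset_closure hx)).trans (le_max_left _ _)⟩

theorem isFiniteMeasure_restrict (hΩ : Bornology.IsBounded Ω) :
    IsFiniteMeasure (volume.restrict Ω) :=
  ⟨by simpa using hΩ.measure_lt_top⟩

theorem memLp_restrict_of_continuous (hΩo : IsOpen Ω) (hΩ : Bornology.IsBounded Ω) {g : E d → ℝ}
    (hg : Continuous g) (p : ENNReal) : MemLp g p (volume.restrict Ω) := by
  have := isFiniteMeasure_restrict hΩ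
  obtain ⟨C, -, hC⟩ := exists_bound_of_continuous hΩ hg
  refine MemLp.of_bound hg.aestronglyMeasurable C ?_
  filter_upwards [ae_restrict_mem hΩo.measurableSet] with x hx using hC x hx

open Classical in
/-- The functional `u ↦ ∫_Ω u g` on `L²(Ω)` (zero unless `g ∈ L²(Ω)`). -/
def pairL2 (Ω : Set (E d)) (g : E d → ℝ) : L2 Ω →L[ℝ] ℝ :=
  if h : MemLp g 2 (volume.restrict Ω) then innerSL ℝ (h.toLp g) else 0

theorem pairL2_apply {g : E d → ℝ} (h : MemLp g 2 (volume.restrict Ω)) (u : L2 Ω) :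
    pairL2 Ω g u = ∫ x in Ω, u x * g x := by
  rw [pairL2, dif_pos h, innerSL_apply_apply, L2.inner_def]
  refine integral_congr_ae ?_
  filter_upwards [h.coeFn_toLp] with x hx
  simp [hx]

open Classical in
/-- The multiplication operator `u ↦ g u` on `L²(Ω)` (zero unless `g ∈ L^∞(Ω)`). -/
def mulL2 (Ω : Set (E d)) (g : E d → ℝ) : L2 Ω →L[ℝ] L2 Ω :=
  if h : MemLp g ⊤ (volume.restrict Ω) then
    (ContinuousLinearMap.mul ℝ ℝ).holderL (volume.restrict Ω) ⊤ 2 2 (h.toLp g) else 0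

theorem coeFn_mulL2 {g : E d → ℝ} (h : MemLp g ⊤ (volume.restrict Ω)) (u : L2 Ω) :
    mulL2 Ω g u =ᵐ[volume.restrict Ω] fun x => g x * u x := by
  rw [mulL2, dif_pos h]
  refine ((ContinuousLinearMap.mul ℝ ℝ).coeFn_holder (r := 2) (h.toLp g) u).trans ?_
  filter_upwards [h.coeFn_toLp] with x hx
  simp [hx]

theorem norm_mulL2_le {g : E d → ℝ} (hΩo : IsOpen Ω) (h : MemLp g ⊤ (volume.restrict Ω)) {C : ℝ}
    (hC : ∀ x ∈ Ω, |g x| ≤ C) (u : L2 Ω) : ‖mulL2 Ω g u‖ ≤ C * ‖u‖ := by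
  refine Lp.norm_le_mul_norm_of_ae_le_mul ?_
  filter_upwards [coeFn_mulL2 h u, ae_restrict_mem hΩo.measurableSet] with x hx hxΩ
  rw [hx, norm_mul]
  exact mul_le_mul_of_nonneg_right (hC x hxΩ) (norm_nonneg _)

theorem norm_sq_eq_integral (u : L2 Ω) : ‖u‖ ^ 2 = ∫ x in Ω, (u x) ^ 2 := by
  rw [← real_inner_self_eq_norm_sq, L2.inner_def]
  simp [sq]

theorem integrable_mul {g : E d → ℝ} (h : MemLp g 2 (volume.restrict Ω)) (u : L2 Ω) :
    Integrable (fun x => u x * g x) (volume.restrict Ω) :=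
  (Lp.memLp u).integrable_mul h

/-! ### Second order jets with vanishing Cauchy data -/

/-- Triples `(v, ∇v, D²v)` of candidates for a function and its weak derivatives, with no relation
between the components. They form a Banach space in which `H²(Ω)` embeds by `H2.jet`. -/
abbrev Jet (Ω : Set (E d)) := L2 Ω × (Fin d → L2 Ω) × (Fin d → Fin d → L2 Ω)

/-- The jet of an `H²` function. -/
def H2.jet (v : H2 Ω) : Jet Ω := (v.val, v.grad, v.hess)

theorem H2.jet_injective : Function.Injective (H2.jet : H2 Ω → Jet Ω) := by
  intro v w h
  simp only [H2.jet, Prod.mk.injEq] at h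
  exact H2.ext h.1 h.2.1 h.2.2

/-- The functional `∫_Ω (v ∂ᵢφ + (∂ᵢv) φ)`. -/
def greenFst (Ω : Set (E d)) (φ : E d → ℝ) (i : Fin d) : Jet Ω →ₗ[ℝ] ℝ where
  toFun j := pairL2 Ω (partialDeriv i φ) j.1 + pairL2 Ω φ (j.2.1 i)
  map_add' j k := by simp; ring
  map_smul' a j := by simp; ring

/-- The functional `∫_Ω ((∂ᵢv) ∂ⱼφ + (∂ⱼ∂ᵢv) φ)`. -/
def greenSnd (Ω : Set (E d)) (φ : E d → ℝ) (i j : Fin d) : Jet Ω →ₗ[ℝ] ℝ where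
  toFun k := pairL2 Ω (partialDeriv j φ) (k.2.1 i) + pairL2 Ω φ (k.2.2 i j)
  map_add' j k := by simp; ring
  map_smul' a j := by simp; ring

/-- The functional `∫_Ω ((Δv) φ + ∇v · ∇φ)`. -/
def greenLaplace (Ω : Set (E d)) (φ : E d → ℝ) : Jet Ω →ₗ[ℝ] ℝ where
  toFun k := ∑ i, (pairL2 Ω φ (k.2.2 i i) + pairL2 Ω (partialDeriv i φ) (k.2.1 i))
  map_add' j k := by simp [← Finset.sum_add_distrib]; congr; ext; ring
  map_smul' a j := by simp [Finset.mul_sum, mul_add]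

/-- The jets of the functions in `H²(Ω)` with vanishing Cauchy data: the Green formulas hold without
boundary terms. The first formula, for test functions with compact support in `Ω`, includes the
statement that the second component is the weak gradient of the first. -/
def zeroJets (Ω : Set (E d)) : Submodule ℝ (Jet Ω) :=
  (⨅ (φ : {φ : E d → ℝ // ContDiff ℝ ∞ φ}) (i : Fin d), (greenFst Ω φ.1 i).ker) ⊓
  (⨅ (φ : {φ : E d → ℝ // ContDiff ℝ ∞ φ ∧ HasCompactSupport φ ∧ tsupport φ ⊆ Ω}) (i : Fin d)
    (j : Fin d), (greenSnd Ω φ.1 i j).ker) ⊓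
  (⨅ (φ : {φ : E d → ℝ // ContDiff ℝ ∞ φ}), (greenLaplace Ω φ.1).ker)

theorem mem_zeroJets {k : Jet Ω} : k ∈ zeroJets Ω ↔
    (∀ φ : E d → ℝ, ContDiff ℝ ∞ φ → ∀ i, greenFst Ω φ i k = 0) ∧
    (∀ φ : E d → ℝ, ContDiff ℝ ∞ φ → HasCompactSupport φ → tsupport φ ⊆ Ω →
      ∀ i j, greenSnd Ω φ i j k = 0) ∧
    (∀ φ : E d → ℝ, ContDiff ℝ ∞ φ → greenLaplace Ω φ k = 0) := by
  simp [zeroJets, Submodule.mem_iInf, and_assoc]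

theorem isClosed_zeroJets : IsClosed (zeroJets Ω : Set (Jet Ω)) := by
  simp only [zeroJets, Submodule.coe_inf, Submodule.coe_iInf]
  refine (IsClosed.inter ?_ ?_).inter ?_
  · refine isClosed_iInter fun φ => isClosed_iInter fun i => ?_
    refine isClosed_singleton.preimage (f := greenFst Ω φ.1 i) ?_
    simp only [greenFst, LinearMap.coe_mk, AddHom.coe_mk]
    fun_prop
  · refine isClosed_iInter fun φ => isClosed_iInter fun i => isClosed_iInter fun j => ?_
    refine isClosed_singleton.preimage (f := greenSnd Ω φ.1 i j) ?_
    simp only [greenSnd, LinearMap.coe_mk, AddHom.coe_mk]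
    fun_prop
  · refine isClosed_iInter fun φ => ?_
    refine isClosed_singleton.preimage (f := greenLaplace Ω φ.1) ?_
    simp only [greenLaplace, LinearMap.coe_mk, AddHom.coe_mk]
    fun_prop

theorem continuous_partialDeriv {φ : E d → ℝ} (hφ : ContDiff ℝ ∞ φ) (i : Fin d) :
    Continuous (partialDeriv i φ) :=
  (hφ.continuous_fderiv (by simp)).clm_apply continuous_const

theorem contDiff_partialDeriv {φ : E d → ℝ} (hφ : ContDiff ℝ ∞ φ) (i : Fin d) :
    ContDiff ℝ ∞ (partialDeriv i φ) :=
  (hφ.fderiv_right (m := ∞) (by simp)).clm_apply contDiff_const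

section Green

variable (hΩo : IsOpen Ω) (hΩ : Bornology.IsBounded Ω) {φ : E d → ℝ} (hφ : ContDiff ℝ ∞ φ)
include hΩo hΩ hφ

theorem greenFst_jet (v : H2 Ω) (i : Fin d) :
    greenFst Ω φ i v.jet = ∫ x in Ω, (v.val x * partialDeriv i φ x + v.grad i x * φ x) := by
  have h1 := memLp_restrict_of_continuous hΩo hΩ hφ.continuous 2
  have h2 := memLp_restrict_of_continuous hΩo hΩ (continuous_partialDeriv hφ i) 2
  rw [integral_add (integrable_mul h2 _) (integrable_mul h1 _)]
  simp [greenFst, H2.jet, pairL2_apply h1, pairL2_apply h2]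

theorem greenLaplace_jet (v : H2 Ω) :
    greenLaplace Ω φ v.jet =
      ∫ x in Ω, (v.laplacian x * φ x + ∑ i, v.grad i x * partialDeriv i φ x) := by
  have h1 := memLp_restrict_of_continuous hΩo hΩ hφ.continuous 2
  have h2 := fun i => memLp_restrict_of_continuous hΩo hΩ (continuous_partialDeriv hφ i) 2
  simp only [H2.laplacian, Finset.sum_mul, ← Finset.sum_add_distrib]
  have h3 : ∀ i, Integrable (fun x => v.hess i i x * φ x + v.grad i x * partialDeriv i φ x)
      (volume.restrict Ω) := fun i => (integrable_mul h1 _).add (integrable_mul (h2 i) _)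
  rw [integral_finsetSum _ fun i _ => h3 i]
  simp only [greenLaplace, H2.jet, LinearMap.coe_mk, AddHom.coe_mk]
  refine Finset.sum_congr rfl fun i _ => ?_
  rw [integral_add (integrable_mul h1 _) (integrable_mul (h2 i) _), pairL2_apply h1,
    pairL2_apply (h2 i)]

theorem greenSnd_eq_zero_iff (k : Jet Ω) (i j : Fin d) : greenSnd Ω φ i j k = 0 ↔
    ∫ x in Ω, k.2.1 i x * partialDeriv j φ x = - ∫ x in Ω, k.2.2 i j x * φ x := by
  have h1 := memLp_restrict_of_continuous hΩo hΩ hφ.continuous 2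
  have h2 := memLp_restrict_of_continuous hΩo hΩ (continuous_partialDeriv hφ j) 2
  simp only [greenSnd, LinearMap.coe_mk, AddHom.coe_mk, pairL2_apply h1, pairL2_apply h2]
  exact add_eq_zero_iff_eq_neg

theorem greenFst_eq_zero_iff (k : Jet Ω) (i : Fin d) : greenFst Ω φ i k = 0 ↔
    ∫ x in Ω, k.1 x * partialDeriv i φ x = - ∫ x in Ω, k.2.1 i x * φ x := by
  have h1 := memLp_restrict_of_continuous hΩo hΩ hφ.continuous 2
  have h2 := memLp_restrict_of_continuous hΩo hΩ (continuous_partialDeriv hφ i) 2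
  simp only [greenFst, LinearMap.coe_mk, AddHom.coe_mk, pairL2_apply h1, pairL2_apply h2]
  exact add_eq_zero_iff_eq_neg

end Green

variable {N : ℕ} {G Q : Fin N → E d → ℝ}

/-- The boundary integrals in the Green formulas depend on the Cauchy data only, so that they cancel
in the difference of two admissible functions. -/
theorem jet_sub_jet_mem_zeroJets (hΩo : IsOpen Ω) (hΩ : Bornology.IsBounded Ω) {V W : Fin N → H2 Ω}
    (hV : V ∈ admissible Ω G Q) (hW : W ∈ admissible Ω G Q) (m : Fin N) :
    (V m).jet - (W m).jet ∈ zeroJets Ω := by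
  refine mem_zeroJets.2 ⟨fun φ hφ i => ?_, fun φ hφ h1 h2 i j => ?_, fun φ hφ => ?_⟩
  · rw [map_sub, greenFst_jet hΩo hΩ hφ, greenFst_jet hΩo hΩ hφ, (hV m).1.2 φ hφ i,
      (hW m).1.2 φ hφ i, sub_self]
  · rw [map_sub, (greenSnd_eq_zero_iff hΩo hΩ hφ _ i j).2 ((V m).weak_hess i j φ hφ h1 h2),
      (greenSnd_eq_zero_iff hΩo hΩ hφ _ i j).2 ((W m).weak_hess i j φ hφ h1 h2), sub_self]
  · rw [map_sub, greenLaplace_jet hΩo hΩ hφ, greenLaplace_jet hΩo hΩ hφ, (hV m).2.2 φ hφ,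
      (hW m).2.2 φ hφ, sub_self]

theorem exists_admissible_jet_eq_add (hΩo : IsOpen Ω) (hΩ : Bornology.IsBounded Ω)
    {V : Fin N → H2 Ω} (hV : V ∈ admissible Ω G Q) {k : Fin N → Jet Ω}
    (hk : ∀ m, k m ∈ zeroJets Ω) :
    ∃ W ∈ admissible Ω G Q, ∀ m, (W m).jet = (V m).jet + k m := by
  have hk' := fun m => mem_zeroJets.1 (hk m)
  let W : Fin N → H2 Ω := fun m =>
    { val := ((V m).jet + k m).1
      grad := ((V m).jet + k m).2.1
      hess := ((V m).jet + k m).2.2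
      weak_grad := fun i φ hφ h1 h2 => by
        refine (greenFst_eq_zero_iff hΩo hΩ hφ _ i).1 ?_
        rw [map_add, (hk' m).1 φ hφ i, add_zero]
        exact (greenFst_eq_zero_iff hΩo hΩ hφ _ i).2 ((V m).weak_grad i φ hφ h1 h2)
      weak_hess := fun i j φ hφ h1 h2 => by
        refine (greenSnd_eq_zero_iff hΩo hΩ hφ _ i j).1 ?_
        rw [map_add, (hk' m).2.1 φ hφ h1 h2 i j, add_zero]
        exact (greenSnd_eq_zero_iff hΩo hΩ hφ _ i j).2 ((V m).weak_hess i j φ hφ h1 h2) }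
  have hW : ∀ m, (W m).jet = (V m).jet + k m := fun m => rfl
  refine ⟨W, fun m => ⟨⟨(hV m).1.1, fun φ hφ i => ?_⟩, (hV m).2.1, fun φ hφ => ?_⟩, hW⟩
  · rw [← greenFst_jet hΩo hΩ hφ, hW, map_add, (hk' m).1 φ hφ i, add_zero,
      greenFst_jet hΩo hΩ hφ, (hV m).1.2 φ hφ i]
  · rw [← greenLaplace_jet hΩo hΩ hφ, hW, map_add, (hk' m).2.2 φ hφ, add_zero,
      greenLaplace_jet hΩo hΩ hφ, (hV m).2.2 φ hφ]

end CarlemanLS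
end

noncomputable section

namespace CarlemanLS

variable {d : ℕ} {Ω : Set (E d)}

/-! ### Exponentials as test functions -/

/-- The complex exponential `x ↦ exp (∑ᵢ ζᵢ xᵢ)`. -/
def expFun (ζ : Fin d → ℂ) (x : E d) : ℂ := Complex.exp (∑ i, ζ i * (x i : ℂ))

theorem contDiff_expFun (ζ : Fin d → ℂ) : ContDiff ℝ ∞ (expFun ζ) := by
  unfold expFun
  refine ContDiff.cexp (ContDiff.sum fun i _ => contDiff_const.mul ?_)
  exact Complex.ofRealCLM.contDiff.comp (by fun_prop)

theorem expFun_add (ζ η : Fin d → ℂ) (x : E d) : expFun (ζ + η) x = expFun ζ x * expFun η x := by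
  simp [expFun, ← Complex.exp_add, add_mul, Finset.sum_add_distrib]

theorem hasFDerivAt_expFun (ζ : Fin d → ℂ) (x : E d) :
    HasFDerivAt (expFun ζ) (expFun ζ x •
      ∑ i, ζ i • (Complex.ofRealCLM ∘L (EuclideanSpace.proj i : E d →L[ℝ] ℝ))) x := by
  unfold expFun
  refine HasFDerivAt.cexp ?_
  refine HasFDerivAt.fun_sum fun i _ => ?_
  refine HasFDerivAt.const_mul ?_ (ζ i)
  exact (Complex.ofRealCLM ∘L (EuclideanSpace.proj i : E d →L[ℝ] ℝ)).hasFDerivAt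

theorem partialDeriv_re_expFun (a : ℂ) (ζ : Fin d → ℂ) (i : Fin d) :
    partialDeriv i (fun x => (a * expFun ζ x).re) = fun x => (a * ζ i * expFun ζ x).re := by
  funext x
  have h := Complex.reCLM.hasFDerivAt.comp x ((hasFDerivAt_expFun ζ x).const_mul a)
  have h' : HasFDerivAt (fun x => (a * expFun ζ x).re) _ x := h
  rw [partialDeriv, h'.fderiv]
  simp [PiLp.single_apply, -Complex.mul_re, apply_ite ((↑) : ℝ → ℂ)]
  congr 1
  ring

theorem contDiff_re_expFun (a : ℂ) (ζ : Fin d → ℂ) :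
    ContDiff ℝ ∞ (fun x => (a * expFun ζ x).re) :=
  Complex.reCLM.contDiff.comp (contDiff_const.mul (contDiff_expFun ζ))

/-- The Fourier-Laplace transform `ζ ↦ ∫_Ω u(x) exp (∑ᵢ ζᵢ xᵢ) dx` of `u ∈ L²(Ω)`. -/
def expInt (Ω : Set (E d)) (ζ : Fin d → ℂ) (u : L2 Ω) : ℂ := ∫ x in Ω, (u x : ℂ) * expFun ζ x

theorem memLp_two_restrict_complex (hΩo : IsOpen Ω) (hΩ : Bornology.IsBounded Ω) {g : E d → ℂ}
    (hg : Continuous g) : MemLp g 2 (volume.restrict Ω) := by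
  have := isFiniteMeasure_restrict hΩ
  obtain ⟨C, hC⟩ := hΩ.isCompact_closure.exists_bound_of_continuousOn hg.continuousOn
  refine MemLp.of_bound hg.aestronglyMeasurable C ?_
  filter_upwards [ae_restrict_mem hΩo.measurableSet] with x hx using hC x (subset_closure hx)

theorem integrable_mul_expFun (hΩo : IsOpen Ω) (hΩ : Bornology.IsBounded Ω) (ζ : Fin d → ℂ)
    (u : L2 Ω) : Integrable (fun x => (u x : ℂ) * expFun ζ x) (volume.restrict Ω) :=
  (Lp.memLp u).ofReal.integrable_mul
    (memLp_two_restrict_complex hΩo hΩ (contDiff_expFun ζ).continuous)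

theorem pairL2_re_expFun (hΩo : IsOpen Ω) (hΩ : Bornology.IsBounded Ω) (a : ℂ) (ζ : Fin d → ℂ)
    (u : L2 Ω) : pairL2 Ω (fun x => (a * expFun ζ x).re) u = (a * expInt Ω ζ u).re := by
  rw [pairL2_apply (memLp_restrict_of_continuous hΩo hΩ (contDiff_re_expFun a ζ).continuous 2),
    expInt, ← integral_const_mul]
  have h := integral_re ((integrable_mul_expFun hΩo hΩ ζ u).const_mul a)
  simp only [RCLike.re_eq_complex_re] at h
  rw [← h]
  refine integral_congr_ae (.of_forall fun x => ?_)
  have : a * (u x * expFun ζ x) = (u x : ℂ) * (a * expFun ζ x) := by ring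
  simp only [this, Complex.re_ofReal_mul]

/-- Testing with all `a` recovers a complex identity from the Green formulas, whose test functions
are real. -/
theorem eq_zero_of_forall_re_mul_eq_zero {z : ℂ} (h : ∀ a : ℂ, (a * z).re = 0) : z = 0 := by
  have h1 := h 1
  have h2 := h Complex.I
  apply Complex.ext <;> simp_all

/-- The Laplacian of a jet. -/
def Jet.lap : Jet Ω →L[ℝ] L2 Ω where
  toFun k := ∑ i, k.2.2 i i
  map_add' := by simp [Finset.sum_add_distrib]
  map_smul' := by simp [Finset.smul_sum]
  cont := by fun_prop

theorem Jet.lap_apply (k : Jet Ω) : Jet.lap k = ∑ i, k.2.2 i i := rfl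

section

variable (hΩo : IsOpen Ω) (hΩ : Bornology.IsBounded Ω) {k : Jet Ω} (hk : k ∈ zeroJets Ω)
include hΩo hΩ hk

theorem expInt_grad (ζ : Fin d → ℂ) (i : Fin d) :
    expInt Ω ζ (k.2.1 i) = - ζ i * expInt Ω ζ k.1 := by
  rw [← sub_eq_zero]
  refine eq_zero_of_forall_re_mul_eq_zero fun a => ?_
  have h := (mem_zeroJets.1 hk).1 _ (contDiff_re_expFun a ζ) i
  simp only [greenFst, partialDeriv_re_expFun, LinearMap.coe_mk, AddHom.coe_mk,
    pairL2_re_expFun hΩo hΩ, ← Complex.add_re] at h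
  rw [← h]
  congr 1
  ring

/-- Green's second identity for a function with vanishing Cauchy data and a complex exponential. -/
theorem expInt_lap (ζ : Fin d → ℂ) :
    expInt Ω ζ (Jet.lap k) = (∑ i, ζ i ^ 2) * expInt Ω ζ k.1 := by
  rw [← sub_eq_zero]
  refine eq_zero_of_forall_re_mul_eq_zero fun a => ?_
  have h := (mem_zeroJets.1 hk).2.2 _ (contDiff_re_expFun a ζ)
  simp only [greenLaplace, partialDeriv_re_expFun, LinearMap.coe_mk, AddHom.coe_mk,
    Finset.sum_add_distrib] at h
  rw [← map_sum, ← Jet.lap_apply] at h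
  simp only [pairL2_re_expFun hΩo hΩ, expInt_grad hΩo hΩ hk, ← Complex.re_sum,
    ← Complex.add_re] at h
  rw [← h]
  congr 1
  simp only [mul_sub, Finset.sum_mul, Finset.mul_sum]
  rw [sub_eq_add_neg, ← Finset.sum_neg_distrib]
  congr 1
  exact Finset.sum_congr rfl fun i _ => by ring

end

/-! ### Extension by zero and its Fourier transform -/

/-- The extension of `u ∈ L²(Ω)` by zero, as a complex valued function. -/
def zext (u : L2 Ω) : E d → ℂ := Ω.indicator fun x => (u x : ℂ)

/-- The frequency `ζ = -2πi ξ`, for which `exp (∑ᵢ ζᵢ xᵢ)` is the Fourier character. -/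
def freq (ξ : E d) (i : Fin d) : ℂ := -(2 * Real.pi * Complex.I) * (ξ i : ℂ)

theorem norm_mul_freq_le (i j : Fin d) (ξ : E d) :
    ‖freq ξ i‖ * ‖freq ξ j‖ ≤ ‖∑ i, freq ξ i ^ 2‖ := by
  have h1 : ∀ i, ‖freq ξ i‖ = 2 * Real.pi * |ξ i| := fun i => by
    simp [freq, abs_of_pos Real.pi_pos]
  have h2 : (∑ i, freq ξ i ^ 2) = ((-(2 * Real.pi) ^ 2 * ∑ i, ξ i ^ 2 : ℝ) : ℂ) := by
    push_cast
    rw [Finset.mul_sum]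
    refine Finset.sum_congr rfl fun i _ => ?_
    simp only [freq]
    linear_combination (2 * Real.pi * (ξ i : ℂ)) ^ 2 * Complex.I_sq
  have h3 : ∀ i, ξ i ^ 2 ≤ ∑ i, ξ i ^ 2 := fun i =>
    Finset.single_le_sum (fun i _ => sq_nonneg (ξ i)) (Finset.mem_univ i)
  have h5 : 0 ≤ ∑ i, ξ i ^ 2 := Finset.sum_nonneg fun i _ => sq_nonneg _
  rw [h1, h1, h2, Complex.norm_real, Real.norm_eq_abs, abs_mul, abs_neg,
    abs_of_nonneg (sq_nonneg (2 * Real.pi)), abs_of_nonneg h5]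
  have h4 : |ξ i| * |ξ j| ≤ ∑ i, ξ i ^ 2 := by
    nlinarith [h3 i, h3 j, sq_abs (ξ i), sq_abs (ξ j), sq_nonneg (|ξ i| - |ξ j|)]
  nlinarith [mul_le_mul_of_nonneg_left h4 (sq_nonneg (2 * Real.pi))]

section

variable (hΩo : IsOpen Ω) (hΩ : Bornology.IsBounded Ω)
include hΩo

theorem memLp_zext (u : L2 Ω) : MemLp (zext u) 2 :=
  (memLp_indicator_iff_restrict hΩo.measurableSet).2 (Lp.memLp u).ofReal

theorem integrable_zext (hΩ : Bornology.IsBounded Ω) (u : L2 Ω) : Integrable (zext u) := by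
  have := isFiniteMeasure_restrict hΩ
  exact (integrable_indicator_iff hΩo.measurableSet).2
    ((Lp.memLp u).ofReal.integrable (by norm_num))

theorem norm_sq_eq_integral_zext (u : L2 Ω) : ‖u‖ ^ 2 = ∫ x, ‖zext u x‖ ^ 2 := by
  rw [norm_sq_eq_integral, ← integral_indicator hΩo.measurableSet]
  congr 1
  funext x
  by_cases hx : x ∈ Ω <;> simp [zext, hx]

theorem fourier_zext (u : L2 Ω) (ξ : E d) : 𝓕 (zext u) ξ = expInt Ω (freq ξ) u := by
  rw [Real.fourier_eq', expInt, ← integral_indicator hΩo.measurableSet]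
  congr 1
  funext x
  by_cases hx : x ∈ Ω
  · simp only [zext, hx, indicator_of_mem, smul_eq_mul, expFun, freq]
    rw [mul_comm]
    congr 2
    simp only [PiLp.inner_apply, RCLike.inner_apply, conj_trivial]
    push_cast
    rw [Finset.mul_sum, Finset.sum_mul]
    exact Finset.sum_congr rfl fun i _ => by ring
  · simp [zext, hx]

include hΩ

theorem integral_norm_sq_fourier_zext (u : L2 Ω) : ∫ ξ, ‖𝓕 (zext u) ξ‖ ^ 2 = ‖u‖ ^ 2 := by
  rw [integral_norm_sq_fourier_eq (integrable_zext hΩo hΩ u) (memLp_zext hΩo u),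
    norm_sq_eq_integral_zext hΩo]

theorem integrable_norm_sq_fourier_zext (u : L2 Ω) : Integrable fun ξ => ‖𝓕 (zext u) ξ‖ ^ 2 :=
  (memLp_fourier (integrable_zext hΩo hΩ u) (memLp_zext hΩo u)).integrable_norm_pow (by norm_num)

variable {k : Jet Ω} (hk : k ∈ zeroJets Ω)
include hk

theorem fourier_zext_grad (i : Fin d) (ξ : E d) :
    𝓕 (zext (k.2.1 i)) ξ = - freq ξ i * 𝓕 (zext k.1) ξ := by
  simp only [fourier_zext hΩo, expInt_grad hΩo hΩ hk]

theorem fourier_zext_lap (ξ : E d) :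
    𝓕 (zext (Jet.lap k)) ξ = (∑ i, freq ξ i ^ 2) * 𝓕 (zext k.1) ξ := by
  simp only [fourier_zext hΩo, expInt_lap hΩo hΩ hk]

/-- On the Fourier side this is `t² ≤ 1 + t⁴` with `t = 2π|ξᵢ|`. -/
theorem norm_grad_sq_le (i : Fin d) : ‖k.2.1 i‖ ^ 2 ≤ ‖k.1‖ ^ 2 + ‖Jet.lap k‖ ^ 2 := by
  have hi := integrable_norm_sq_fourier_zext hΩo hΩ
  rw [← integral_norm_sq_fourier_zext hΩo hΩ, ← integral_norm_sq_fourier_zext hΩo hΩ,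
    ← integral_norm_sq_fourier_zext hΩo hΩ, ← integral_add (hi _) (hi _)]
  refine integral_mono (hi _) ((hi _).add (hi _)) fun ξ => ?_
  simp only [fourier_zext_grad hΩo hΩ hk, fourier_zext_lap hΩo hΩ hk, norm_mul, norm_neg, mul_pow]
  have h := norm_mul_freq_le i i ξ
  rw [← sq] at h
  have h' : ‖freq ξ i‖ ^ 2 ≤ 1 + ‖∑ i, freq ξ i ^ 2‖ ^ 2 := by
    nlinarith [sq_nonneg (‖∑ i, freq ξ i ^ 2‖ - 1), norm_nonneg (∑ i, freq ξ i ^ 2)]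
  nlinarith [mul_le_mul_of_nonneg_right h' (sq_nonneg ‖𝓕 (zext k.1) ξ‖)]

end

theorem fourier_partialDeriv {φ : E d → ℝ} (hφ : ContDiff ℝ ∞ φ) (hc : HasCompactSupport φ)
    (i : Fin d) (ξ : E d) :
    𝓕 (fun x => (partialDeriv i φ x : ℂ)) ξ = - freq ξ i * 𝓕 (fun x => (φ x : ℂ)) ξ := by
  set f : E d → ℂ := fun x => (φ x : ℂ) with hf
  have hf1 : ContDiff ℝ ∞ f := Complex.ofRealCLM.contDiff.comp hφ
  have hfc : HasCompactSupport f := hc.comp_left (g := fun t : ℝ => (t : ℂ)) (by simp)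
  have hfd : Continuous (fderiv ℝ f) := hf1.continuous_fderiv (by simp)
  have hfi : Integrable (fderiv ℝ f) := hfd.integrable_of_hasCompactSupport (hfc.fderiv ℝ)
  have h := Real.fourier_fderiv (hf1.continuous.integrable_of_hasCompactSupport hfc)
    (hf1.differentiable (by simp)) hfi
  have h2 := congrArg (fun L => L (EuclideanSpace.single i 1)) (congrFun h ξ)
  rw [Real.fourier_continuousLinearMap_apply hfi] at h2
  have h3 : (fun x => (partialDeriv i φ x : ℂ)) =
      fun x => fderiv ℝ f x (EuclideanSpace.single i 1) := by
    funext x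
    have := (Complex.ofRealCLM.hasFDerivAt.comp x
      ((hφ.differentiable (by simp)) x).hasFDerivAt).fderiv
    have h' : fderiv ℝ f x = _ := this
    rw [h', partialDeriv]
    simp
  rw [h3, h2]
  have h4 : innerSL ℝ ξ (EuclideanSpace.single i 1) = ξ i := by
    rw [innerSL_apply_apply, EuclideanSpace.inner_single_right]
    simp
  simp [VectorFourier.fourierSMulRight_apply, freq, h4]
  ring

theorem hasCompactSupport_partialDeriv {φ : E d → ℝ} (hc : HasCompactSupport φ) (i : Fin d) :
    HasCompactSupport (partialDeriv i φ) :=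
  hc.fderiv_apply ℝ _

end CarlemanLS
end

noncomputable section

namespace CarlemanLS

variable {d : ℕ} {Ω : Set (E d)}

/-! ### The bound for the second derivatives -/

section

variable (hΩo : IsOpen Ω) (hΩ : Bornology.IsBounded Ω) {k : Jet Ω} (hk : k ∈ zeroJets Ω)
include hΩo hΩ hk

theorem integral_hess_mul_eq {φ : E d → ℝ} (hφ : ContDiff ℝ ∞ φ) (hc : HasCompactSupport φ)
    (hs : tsupport φ ⊆ Ω) (i j : Fin d) :
    ∫ x in Ω, k.2.2 i j x * φ x =
      ∫ x in Ω, k.1 x * partialDeriv i (partialDeriv j φ) x := by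
  have h1 := (greenFst_eq_zero_iff hΩo hΩ (contDiff_partialDeriv hφ j) k i).1
    ((mem_zeroJets.1 hk).1 _ (contDiff_partialDeriv hφ j) i)
  have h2 := (greenSnd_eq_zero_iff hΩo hΩ hφ k i j).1 ((mem_zeroJets.1 hk).2.1 φ hφ hc hs i j)
  rw [h1, h2, neg_neg]

/-- The Green formulas do not say that `∂ⱼ ∂ᵢ v`, extended by zero, is a weak derivative on the whole
space. Instead, the `L²(ℝ^d)` function with Fourier transform `(2πi)² ξᵢ ξⱼ v̂` has norm at most
`‖Δv‖`, and it agrees with `∂ⱼ ∂ᵢ v` on `Ω`. -/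
theorem norm_hess_le (i j : Fin d) : ‖k.2.2 i j‖ ≤ ‖Jet.lap k‖ := by
  set m : E d → ℂ := fun ξ => freq ξ i * freq ξ j with hm
  have hmc : Continuous m := by
    simp only [hm, freq]
    fun_prop
  have hconj : ∀ ξ, (starRingEnd ℂ) (m ξ) = m ξ := fun ξ => by
    simp [hm, freq, Complex.conj_ofReal, Complex.conj_ofNat]
  have hle : ∀ ξ, ‖m ξ * 𝓕 (zext k.1) ξ‖ ≤ ‖𝓕 (zext (Jet.lap k)) ξ‖ := fun ξ => by
    rw [fourier_zext_lap hΩo hΩ hk, norm_mul, norm_mul, norm_mul]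
    exact mul_le_mul_of_nonneg_right (norm_mul_freq_le i j ξ) (norm_nonneg _)
  have hvi := integrable_zext hΩo hΩ k.1
  have hv2 := memLp_zext hΩo k.1
  have hH0 : MemLp (fun ξ => m ξ * 𝓕 (zext k.1) ξ) 2 :=
    (memLp_fourier (integrable_zext hΩo hΩ (Jet.lap k)) (memLp_zext hΩo _)).mono
      (hmc.aestronglyMeasurable.mul (memLp_fourier hvi hv2).1) (.of_forall hle)
  set H : Lp ℂ 2 (volume : Measure (E d)) := 𝓕⁻ (hH0.toLp _) with hH
  have hFH : 𝓕 H = hH0.toLp _ := FourierTransform.fourier_fourierInv_eq _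
  -- `H` represents the distribution `∂ⱼ ∂ᵢ v` on `Ω`
  have hrep : ∀ᵐ x, x ∈ Ω → (H x - zext (k.2.2 i j) x) = 0 := by
    refine hΩo.ae_eq_zero_of_integral_contDiff_smul_eq_zero ?_ ?_
    · exact (((Lp.memLp H).locallyIntegrable (by norm_num)).sub
        (integrable_zext hΩo hΩ _).locallyIntegrable).locallyIntegrableOn _
    intro φ hφ hc hs
    set ψ := partialDeriv i (partialDeriv j φ) with hψ
    have hc1 := hasCompactSupport_partialDeriv hc j
    have hc2 : HasCompactSupport ψ := hasCompactSupport_partialDeriv hc1 i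
    have hs1 := contDiff_partialDeriv hφ j
    have hs2 : ContDiff ℝ ∞ ψ := contDiff_partialDeriv hs1 i
    have cts : ∀ {f : E d → ℝ}, ContDiff ℝ ∞ f → HasCompactSupport f →
        Integrable (fun x => (f x : ℂ)) ∧ MemLp (fun x => (f x : ℂ)) 2 := fun hf hfc =>
      ⟨(Complex.continuous_ofReal.comp hf.continuous).integrable_of_hasCompactSupport
        (hfc.comp_left (g := fun t : ℝ => (t : ℂ)) (by simp)),
      (Complex.continuous_ofReal.comp hf.continuous).memLp_of_hasCompactSupport
        (hfc.comp_left (g := fun t : ℝ => (t : ℂ)) (by simp))⟩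
    obtain ⟨hφi, hφ2⟩ := cts hφ hc
    obtain ⟨hψi, hψ2⟩ := cts hs2 hc2
    have hFψ : ∀ ξ, 𝓕 (fun x => (ψ x : ℂ)) ξ = m ξ * 𝓕 (fun x => (φ x : ℂ)) ξ := fun ξ => by
      rw [hψ, fourier_partialDeriv hs1 hc1, fourier_partialDeriv hφ hc, hm]
      ring
    have e1 : ∫ x, φ x • H x = ∫ x, (ψ x : ℂ) * zext k.1 x := by
      calc ∫ x, φ x • H x = ⟪hφ2.toLp _, H⟫_ℂ := by
            rw [L2.inner_def]
            refine integral_congr_ae ?_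
            filter_upwards [hφ2.coeFn_toLp] with x hx
            rw [hx]
            simp [mul_comm]
        _ = ⟪𝓕 (hφ2.toLp _), hH0.toLp _⟫_ℂ := by
            rw [← hFH, Lp.inner_fourier_eq]
        _ = ∫ ξ, ⟪𝓕 (fun x => (ψ x : ℂ)) ξ, 𝓕 (zext k.1) ξ⟫_ℂ := by
            rw [L2.inner_def]
            refine integral_congr_ae ?_
            filter_upwards [coeFn_fourier_toLp_ae_eq hφi hφ2, hH0.coeFn_toLp] with ξ h1 h2
            rw [h1, h2, hFψ]
            simp only [RCLike.inner_apply, map_mul, hconj]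
            ring
        _ = ∫ x, ⟪(ψ x : ℂ), zext k.1 x⟫_ℂ := integral_inner_fourier_eq hψi hψ2 hvi hv2
        _ = _ := by
            simp [mul_comm]
    have e2 : ∀ (f : E d → ℝ) (u : L2 Ω),
        ∫ x, (f x : ℂ) * zext u x = ((∫ x in Ω, u x * f x : ℝ) : ℂ) := fun f u => by
      rw [← integral_complex_ofReal, ← integral_indicator hΩo.measurableSet]
      congr 1
      funext x
      by_cases hx : x ∈ Ω <;> simp [zext, hx, mul_comm]
    have i1 : Integrable (fun x => φ x • H x) := by
      simp only [Complex.real_smul]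
      exact hφ2.integrable_mul (Lp.memLp H)
    have i2 : Integrable (fun x => (φ x : ℂ) * zext (k.2.2 i j) x) :=
      hφ2.integrable_mul (memLp_zext hΩo _)
    calc ∫ x, φ x • (H x - zext (k.2.2 i j) x)
        = ∫ x, (φ x • H x - (φ x : ℂ) * zext (k.2.2 i j) x) := by
          simp only [smul_sub, Complex.real_smul]
      _ = 0 := by
          rw [integral_sub i1 i2, e1, e2, e2, integral_hess_mul_eq hΩo hΩ hk hφ hc hs, sub_self]
  have hnorm : ∀ f : Lp ℂ 2 (volume : Measure (E d)), ‖f‖ ^ 2 = ∫ x, ‖f x‖ ^ 2 := fun f => by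
    have h := inner_self_eq_norm_sq_to_K (𝕜 := ℂ) f
    rw [L2.inner_def] at h
    simp only [inner_self_eq_norm_sq_to_K] at h
    norm_cast at h
    exact_mod_cast h.symm
  refine (sq_le_sq₀ (norm_nonneg _) (norm_nonneg _)).1 ?_
  calc ‖k.2.2 i j‖ ^ 2 = ∫ x, ‖zext (k.2.2 i j) x‖ ^ 2 := norm_sq_eq_integral_zext hΩo _
    _ ≤ ∫ x, ‖H x‖ ^ 2 := by
      refine integral_mono_ae ((memLp_zext hΩo _).integrable_norm_pow (by norm_num))
        ((Lp.memLp H).integrable_norm_pow (by norm_num)) ?_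
      filter_upwards [hrep] with x hx
      by_cases hxΩ : x ∈ Ω
      · rw [sub_eq_zero.1 (hx hxΩ)]
      · simp [zext, hxΩ]
    _ = ‖𝓕 H‖ ^ 2 := by rw [← hnorm, Lp.norm_fourier_eq]
    _ = ∫ ξ, ‖m ξ * 𝓕 (zext k.1) ξ‖ ^ 2 := by
      rw [hFH, hnorm]
      refine integral_congr_ae ?_
      filter_upwards [hH0.coeFn_toLp] with ξ hξ
      rw [hξ]
    _ ≤ ∫ ξ, ‖𝓕 (zext (Jet.lap k)) ξ‖ ^ 2 := by
      refine integral_mono (hH0.integrable_norm_pow (by norm_num))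
        (integrable_norm_sq_fourier_zext hΩo hΩ _) fun ξ => ?_
      exact pow_le_pow_left₀ (norm_nonneg _) (hle ξ) 2
    _ = ‖Jet.lap k‖ ^ 2 := integral_norm_sq_fourier_zext hΩo hΩ _

end

/-! ### The Carleman estimate with a linear weight -/

/-- The linear Carleman weight `exp (τ xᵢ)`. -/
def linWeight (i : Fin d) (τ : ℝ) (x : E d) : ℝ := Real.exp (τ * x i)

theorem continuous_linWeight (i : Fin d) (τ : ℝ) : Continuous (linWeight i τ) := by
  unfold linWeight
  fun_prop

theorem expInt_mulL2_linWeight (hΩo : IsOpen Ω) (hΩ : Bornology.IsBounded Ω) (i : Fin d) (τ : ℝ)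
    (ζ : Fin d → ℂ) (u : L2 Ω) :
    expInt Ω ζ (mulL2 Ω (linWeight i τ) u) = expInt Ω (ζ + Pi.single i (τ : ℂ)) u := by
  unfold expInt
  refine integral_congr_ae ?_
  filter_upwards [coeFn_mulL2
    (memLp_restrict_of_continuous hΩo hΩ (continuous_linWeight i τ) ⊤) u] with x hx
  have : expFun (Pi.single i (τ : ℂ)) x = (linWeight i τ x : ℂ) := by
    simp [expFun, linWeight, Pi.single_apply]
  rw [hx, expFun_add, this]
  push_cast
  ring

/-- A bounded set is disjoint from a sufficiently far translate of itself. -/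
theorem exists_forall_add_notMem (hΩ : Bornology.IsBounded Ω) (i : Fin d) :
    ∃ R : ℝ, 0 < R ∧ ∀ x ∈ Ω, x + EuclideanSpace.single i R ∉ Ω := by
  obtain ⟨C, hC0, hC⟩ := hΩ.exists_pos_norm_le
  refine ⟨2 * C + 1, by positivity, fun x hx hx' => ?_⟩
  have h1 := hC x hx
  have h2 := hC _ hx'
  have h3 : ‖(EuclideanSpace.single i (2 * C + 1) : E d)‖ = 2 * C + 1 := by
    rw [PiLp.norm_single, Real.norm_eq_abs, abs_of_pos (by positivity)]
  have h4 := norm_sub_le (x + EuclideanSpace.single i (2 * C + 1)) x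
  rw [add_sub_cancel_left, h3] at h4
  linarith

/-- The Carleman estimate with the linear weight `exp (τ xᵢ)`, for functions with vanishing Cauchy
data in a set that is disjoint from its translate by `R` in the direction `i`. -/
theorem carleman_estimate (hΩo : IsOpen Ω) (hΩ : Bornology.IsBounded Ω) {i : Fin d} {R : ℝ}
    (hR : 0 < R) (hRΩ : ∀ x ∈ Ω, x + EuclideanSpace.single i R ∉ Ω) {τ : ℝ} (hτ : 0 < τ)
    {k : Jet Ω} (hk : k ∈ zeroJets Ω) :
    2 * τ * ‖mulL2 Ω (linWeight i τ) k.1‖ ≤ R * ‖mulL2 Ω (linWeight i τ) (Jet.lap k)‖ := by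
  set u := mulL2 Ω (linWeight i τ) k.1
  set p := mulL2 Ω (linWeight i τ) (Jet.lap k)
  set h : E d := EuclideanSpace.single i R
  have hui := integrable_zext hΩo hΩ u
  have hu2 := memLp_zext hΩo u
  have hp : ∀ ξ, (4 * Real.pi * τ * |ξ i|) * ‖𝓕 (zext u) ξ‖ ≤ ‖𝓕 (zext p) ξ‖ := fun ξ => by
    rw [fourier_zext hΩo, fourier_zext hΩo, expInt_mulL2_linWeight hΩo hΩ,
      expInt_mulL2_linWeight hΩo hΩ, expInt_lap hΩo hΩ hk, norm_mul]
    refine mul_le_mul_of_nonneg_right ?_ (norm_nonneg _)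
    -- the cross term of `(τ - 2πi ξᵢ)²` is the imaginary part of the symbol
    have him : (∑ j, (freq ξ + Pi.single i (τ : ℂ) : Fin d → ℂ) j ^ 2).im =
        -(4 * Real.pi * τ * ξ i) := by
      rw [Complex.im_sum, Finset.sum_eq_single i]
      · simp [freq, sq]
        ring
      · intro j _ hj
        simp [freq, Pi.single_eq_of_ne hj, sq]
      · simp
    calc 4 * Real.pi * τ * |ξ i| = |(∑ j, (freq ξ + Pi.single i (τ : ℂ) : Fin d → ℂ) j ^ 2).im| := by
          rw [him, abs_neg, abs_mul, abs_of_pos (by positivity : 0 < 4 * Real.pi * τ)]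
      _ ≤ _ := Complex.abs_im_le_norm _
  -- `u` and its translate have disjoint supports, and on the Fourier side their difference is
  -- bounded by `2π R |ξᵢ| ‖û‖`
  set w : E d → ℂ := zext u - (zext u ∘ fun x => x + h) with hw
  have hsi : Integrable (zext u ∘ fun x => x + h) := hui.comp_add_right h
  have hs2 : MemLp (zext u ∘ fun x => x + h) 2 :=
    hu2.comp_measurePreserving (measurePreserving_add_right volume h)
  have hwi : Integrable w := hui.sub hsi
  have hw2 : MemLp w 2 := hu2.sub hs2
  have hFw : ∀ ξ, 𝓕 w ξ = (1 - Complex.exp (Complex.I * (2 * Real.pi * R * ξ i : ℝ))) *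
      𝓕 (zext u) ξ := fun ξ => by
    have h1 : 𝓕 w ξ = 𝓕 (zext u) ξ - 𝓕 (zext u ∘ fun x => x + h) ξ := by
      rw [Real.fourier_eq, Real.fourier_eq, Real.fourier_eq, ← integral_sub]
      · simp [hw, smul_sub]
      · exact (Real.fourierIntegral_convergent_iff ξ).2 hui
      · exact (Real.fourierIntegral_convergent_iff ξ).2 hsi
    have h2 := congrFun (VectorFourier.fourierIntegral_comp_add_right Real.fourierChar volume
      (innerₗ (E d)) (zext u) h) ξ
    have h3 : 𝓕 (zext u ∘ fun x => x + h) ξ = _ := h2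
    rw [h1, h3, sub_mul, one_mul]
    congr 1
    rw [Circle.smul_def, Real.fourierChar_apply, smul_eq_mul]
    congr 2
    simp [h, EuclideanSpace.inner_single_left]
    ring
  have key : (2 * τ) ^ 2 * ‖u‖ ^ 2 ≤ R ^ 2 * ‖p‖ ^ 2 := by
    calc (2 * τ) ^ 2 * ‖u‖ ^ 2 = (2 * τ) ^ 2 * ∫ x, ‖zext u x‖ ^ 2 := by
          rw [norm_sq_eq_integral_zext hΩo]
      _ ≤ (2 * τ) ^ 2 * ∫ x, ‖w x‖ ^ 2 := by
          refine mul_le_mul_of_nonneg_left (integral_mono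
            (hu2.integrable_norm_pow (by norm_num)) (hw2.integrable_norm_pow (by norm_num))
            fun x => ?_) (sq_nonneg _)
          by_cases hx : x ∈ Ω
          · simp [hw, zext, hRΩ x hx]
          · simp [zext, hx]
      _ = ∫ ξ, (2 * τ) ^ 2 * ‖𝓕 w ξ‖ ^ 2 := by
          rw [integral_const_mul, integral_norm_sq_fourier_eq hwi hw2]
      _ ≤ ∫ ξ, R ^ 2 * ‖𝓕 (zext p) ξ‖ ^ 2 := by
          refine integral_mono (((memLp_fourier hwi hw2).integrable_norm_pow
            (by norm_num)).const_mul _)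
            ((integrable_norm_sq_fourier_zext hΩo hΩ _).const_mul _) fun ξ => ?_
          simp only [← mul_pow]
          refine pow_le_pow_left₀ (by positivity) ?_ 2
          have h1 := Real.norm_exp_I_mul_ofReal_sub_one_le (x := 2 * Real.pi * R * ξ i)
          rw [norm_sub_rev, Real.norm_eq_abs, abs_mul,
            abs_of_pos (by positivity : 0 < 2 * Real.pi * R)] at h1
          calc 2 * τ * ‖𝓕 w ξ‖ ≤ 2 * τ * (2 * Real.pi * R * |ξ i| * ‖𝓕 (zext u) ξ‖) := by
                rw [hFw, norm_mul]
                gcongr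
            _ = R * ((4 * Real.pi * τ * |ξ i|) * ‖𝓕 (zext u) ξ‖) := by ring
            _ ≤ R * ‖𝓕 (zext p) ξ‖ := mul_le_mul_of_nonneg_left (hp ξ) hR.le
      _ = R ^ 2 * ‖p‖ ^ 2 := by
          rw [integral_const_mul, integral_norm_sq_fourier_zext hΩo hΩ]
  rw [← mul_pow, ← mul_pow] at key
  exact (sq_le_sq₀ (by positivity) (by positivity)).1 key

end CarlemanLS
end

noncomputable section

namespace CarlemanLS

variable {d N : ℕ} {Ω : Set (E d)}

/-! ### The operator of the system is bounded below -/

theorem mulL2_mulL2 {g h : E d → ℝ} (hΩo : IsOpen Ω) (hΩ : Bornology.IsBounded Ω)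
    (hg : Continuous g) (hh : Continuous h) (u : L2 Ω) :
    mulL2 Ω g (mulL2 Ω h u) = mulL2 Ω (fun x => g x * h x) u := by
  refine Lp.ext ?_
  filter_upwards [coeFn_mulL2 (memLp_restrict_of_continuous hΩo hΩ hg ⊤) (mulL2 Ω h u),
    coeFn_mulL2 (memLp_restrict_of_continuous hΩo hΩ hh ⊤) u,
    coeFn_mulL2 (memLp_restrict_of_continuous hΩo hΩ (g := fun x => g x * h x)
      (hg.mul hh) ⊤) u] with x h1 h2 h3
  rw [h1, h2, h3, mul_assoc]

theorem mulL2_one (hΩo : IsOpen Ω) (hΩ : Bornology.IsBounded Ω) (u : L2 Ω) :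
    mulL2 Ω (fun _ => 1) u = u := by
  refine Lp.ext ?_
  filter_upwards [coeFn_mulL2 (memLp_restrict_of_continuous hΩo hΩ continuous_const ⊤) u] with x h1
  rw [h1, one_mul]

theorem exists_norm_le_norm_mulL2 {g : E d → ℝ} (hΩo : IsOpen Ω) (hΩ : Bornology.IsBounded Ω)
    (hg : Continuous g) (hpos : ∀ x, 0 < g x) :
    ∃ C, 0 < C ∧ ∀ u : L2 Ω, ‖u‖ ≤ C * ‖mulL2 Ω g u‖ := by
  have hgi : Continuous fun x => (g x)⁻¹ := hg.inv₀ fun x => (hpos x).ne'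
  obtain ⟨C, hC0, hC⟩ := exists_bound_of_continuous hΩ hgi
  refine ⟨C, hC0, fun u => ?_⟩
  have h1 : mulL2 Ω (fun x => (g x)⁻¹) (mulL2 Ω g u) = u := by
    rw [mulL2_mulL2 hΩo hΩ hgi hg]
    simp only [inv_mul_cancel₀ (hpos _).ne']
    exact mulL2_one hΩo hΩ u
  calc ‖u‖ = ‖mulL2 Ω (fun x => (g x)⁻¹) (mulL2 Ω g u)‖ := by rw [h1]
    _ ≤ _ := norm_mulL2_le hΩo (memLp_restrict_of_continuous hΩo hΩ hgi ⊤) hC _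

/-- The `m`-th component `Δ Vₘ - c (S V)ₘ` of the linear part of the residual, on jets. -/
def sysOp (Ω : Set (E d)) (c : E d → ℝ) (S : Matrix (Fin N) (Fin N) ℝ) (m : Fin N) :
    (Fin N → Jet Ω) →L[ℝ] L2 Ω where
  toFun k := Jet.lap (k m) - mulL2 Ω c (∑ n, S m n • (k n).1)
  map_add' k l := by
    simp only [Pi.add_apply, map_add, Prod.fst_add, smul_add, Finset.sum_add_distrib]
    abel
  map_smul' a k := by
    simp only [Pi.smul_apply, map_smul, Prod.smul_fst, smul_comm _ a, ← Finset.smul_sum, smul_sub,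
      RingHom.id_apply]
  cont := by fun_prop

theorem sysOp_apply (c : E d → ℝ) (S : Matrix (Fin N) (Fin N) ℝ) (m : Fin N)
    (k : Fin N → Jet Ω) :
    sysOp Ω c S m k = Jet.lap (k m) - mulL2 Ω c (∑ n, S m n • (k n).1) := rfl

/-- The linear part of the residual as an operator into the Hilbert space `L²(Ω)^N`, multiplied by
the weight `g`. -/
def weightedSysOp (Ω : Set (E d)) (g c : E d → ℝ) (S : Matrix (Fin N) (Fin N) ℝ) :
    (Fin N → Jet Ω) →L[ℝ] PiLp 2 (fun _ : Fin N => L2 Ω) :=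
  (PiLp.continuousLinearEquiv 2 ℝ (fun _ : Fin N => L2 Ω)).symm.toContinuousLinearMap ∘L
    ContinuousLinearMap.pi fun m => mulL2 Ω g ∘L sysOp Ω c S m

theorem weightedSysOp_apply (g c : E d → ℝ) (S : Matrix (Fin N) (Fin N) ℝ)
    (k : Fin N → Jet Ω) (m : Fin N) :
    weightedSysOp Ω g c S k m = mulL2 Ω g (sysOp Ω c S m k) := rfl

/-- A linear combination of the components of `V` is controlled by the sum of the norms. -/
theorem norm_sum_smul_le {s : ℝ} {S : Matrix (Fin N) (Fin N) ℝ} (hs : ∀ m n, |S m n| ≤ s)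
    (m : Fin N) (v : Fin N → L2 Ω) : ‖∑ n, S m n • v n‖ ≤ s * ∑ n, ‖v n‖ := by
  rw [Finset.mul_sum]
  refine (norm_sum_le _ _).trans (Finset.sum_le_sum fun n _ => ?_)
  rw [norm_smul]
  exact mul_le_mul_of_nonneg_right (hs m n) (norm_nonneg _)

theorem norm_mulL2_lap_le (hΩo : IsOpen Ω) (hΩ : Bornology.IsBounded Ω) {e c : E d → ℝ}
    (he : Continuous e) (hc : Continuous c) {Cc s : ℝ} (hCc0 : 0 ≤ Cc) (hCc : ∀ x ∈ Ω, |c x| ≤ Cc)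
    {S : Matrix (Fin N) (Fin N) ℝ} (hs : ∀ m n, |S m n| ≤ s) (k : Fin N → Jet Ω) (m : Fin N) :
    ‖mulL2 Ω e (Jet.lap (k m))‖ ≤
      ‖mulL2 Ω e (sysOp Ω c S m k)‖ + Cc * (s * ∑ n, ‖mulL2 Ω e (k n).1‖) := by
  have hlap : Jet.lap (k m) = sysOp Ω c S m k + mulL2 Ω c (∑ n, S m n • (k n).1) := by
    rw [sysOp_apply]
    abel
  have hcomm : ∀ u : L2 Ω, mulL2 Ω e (mulL2 Ω c u) = mulL2 Ω c (mulL2 Ω e u) := fun u => by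
    simp only [mulL2_mulL2 hΩo hΩ he hc, mulL2_mulL2 hΩo hΩ hc he, mul_comm]
  rw [hlap, map_add, hcomm, map_sum]
  simp only [map_smul]
  refine (norm_add_le _ _).trans (add_le_add_right ?_ _)
  exact (norm_mulL2_le hΩo (memLp_restrict_of_continuous hΩo hΩ hc ⊤) hCc _).trans
    (mul_le_mul_of_nonneg_left (norm_sum_smul_le hs m _) hCc0)

/-- The Carleman estimate for the system: if `τ` is so large that the zeroth order term is absorbed,
then the weighted norm of the residual controls the weighted norm of the function. -/
theorem sum_norm_mulL2_linWeight_le (hΩo : IsOpen Ω) (hΩ : Bornology.IsBounded Ω) {i : Fin d}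
    {R : ℝ} (hR : 0 < R) (hRΩ : ∀ x ∈ Ω, x + EuclideanSpace.single i R ∉ Ω) {c : E d → ℝ}
    (hc : Continuous c) {Cc s : ℝ} (hCc0 : 0 ≤ Cc) (hCc : ∀ x ∈ Ω, |c x| ≤ Cc)
    {S : Matrix (Fin N) (Fin N) ℝ} (hs : ∀ m n, |S m n| ≤ s) {τ : ℝ} (hτ0 : 0 < τ)
    (hτ : 2 * τ = R * (N * (Cc * s)) + 1) {k : Fin N → Jet Ω} (hk : ∀ m, k m ∈ zeroJets Ω) :
    ∑ m, ‖mulL2 Ω (linWeight i τ) (k m).1‖ ≤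
      R * ∑ m, ‖mulL2 Ω (linWeight i τ) (sysOp Ω c S m k)‖ := by
  have h1 : ∀ m, 2 * τ * ‖mulL2 Ω (linWeight i τ) (k m).1‖ ≤
      R * (‖mulL2 Ω (linWeight i τ) (sysOp Ω c S m k)‖ +
        Cc * (s * ∑ n, ‖mulL2 Ω (linWeight i τ) (k n).1‖)) := fun m =>
    (carleman_estimate hΩo hΩ hR hRΩ hτ0 (hk m)).trans (mul_le_mul_of_nonneg_left
      (norm_mulL2_lap_le hΩo hΩ (continuous_linWeight i τ) hc hCc0 hCc hs k m) hR.le)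
  have h2 := Finset.sum_le_sum fun m (_ : m ∈ Finset.univ) => h1 m
  rw [← Finset.mul_sum, ← Finset.mul_sum, Finset.sum_add_distrib, Finset.sum_const,
    Finset.card_univ, Fintype.card_fin, nsmul_eq_mul, hτ] at h2
  linarith

theorem exists_abs_le (S : Matrix (Fin N) (Fin N) ℝ) : ∃ s : ℝ, 0 ≤ s ∧ ∀ m n, |S m n| ≤ s := by
  refine ⟨∑ m, ∑ n, |S m n|, by positivity, fun m n => ?_⟩
  exact (Finset.single_le_sum (f := fun n => |S m n|) (fun _ _ => abs_nonneg _)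
    (Finset.mem_univ n)).trans (Finset.single_le_sum (f := fun m => ∑ n, |S m n|)
      (fun _ _ => by positivity) (Finset.mem_univ m))

theorem norm_sysOp_le {g c : E d → ℝ} {C : ℝ} (hC0 : 0 < C)
    (hC : ∀ u : L2 Ω, ‖u‖ ≤ C * ‖mulL2 Ω g u‖)
    (S : Matrix (Fin N) (Fin N) ℝ) (k : Fin N → Jet Ω) (m : Fin N) :
    ‖sysOp Ω c S m k‖ ≤ C * ‖weightedSysOp Ω g c S k‖ := by
  refine (hC _).trans (mul_le_mul_of_nonneg_left ?_ hC0.le)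
  rw [← weightedSysOp_apply]
  exact PiLp.norm_apply_le _ m

theorem exists_norm_val_le_weightedSysOp (hΩo : IsOpen Ω) (hΩ : Bornology.IsBounded Ω) (i : Fin d)
    {g c : E d → ℝ} (hg : Continuous g) (hg0 : ∀ x, 0 < g x) (hc : Continuous c)
    (S : Matrix (Fin N) (Fin N) ℝ) :
    ∃ C, 0 ≤ C ∧ ∀ k : Fin N → Jet Ω, (∀ m, k m ∈ zeroJets Ω) →
      ∀ m, ‖(k m).1‖ ≤ C * ‖weightedSysOp Ω g c S k‖ := by
  obtain ⟨R, hR, hRΩ⟩ := exists_forall_add_notMem hΩ i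
  obtain ⟨Cc, hCc0, hCc⟩ := exists_bound_of_continuous hΩ hc
  obtain ⟨Cg, hCg0, hCg⟩ := exists_norm_le_norm_mulL2 hΩo hΩ hg hg0
  obtain ⟨s, hs0, hs⟩ := exists_abs_le S
  obtain ⟨τ, hτ0, hτ⟩ : ∃ τ : ℝ, 0 < τ ∧ 2 * τ = R * (N * (Cc * s)) + 1 :=
    ⟨(R * (N * (Cc * s)) + 1) / 2, by positivity, by ring⟩
  have he := continuous_linWeight i τ
  obtain ⟨Cp, hCp0, hCp⟩ := exists_bound_of_continuous hΩ he
  obtain ⟨Cm, hCm0, hCm⟩ := exists_norm_le_norm_mulL2 hΩo hΩ he fun x => Real.exp_pos _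
  have hme := memLp_restrict_of_continuous hΩo hΩ he ⊤
  refine ⟨Cm * (R * (N * (Cp * Cg))), by positivity, fun k hk m => ?_⟩
  have h1 : ∀ n, ‖mulL2 Ω (linWeight i τ) (sysOp Ω c S n k)‖ ≤
      Cp * (Cg * ‖weightedSysOp Ω g c S k‖) := fun n =>
    (norm_mulL2_le hΩo hme hCp _).trans
      (mul_le_mul_of_nonneg_left (norm_sysOp_le hCg0 hCg S k n) hCp0.le)
  have h2 := Finset.sum_le_sum fun n (_ : n ∈ Finset.univ) => h1 n
  rw [Finset.sum_const, Finset.card_univ, Fintype.card_fin, nsmul_eq_mul] at h2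
  have h3 := sum_norm_mulL2_linWeight_le hΩo hΩ hR hRΩ hc hCc0.le hCc hs hτ0 hτ hk
  have h4 := Finset.single_le_sum (f := fun m => ‖mulL2 Ω (linWeight i τ) (k m).1‖)
    (fun _ _ => norm_nonneg _) (Finset.mem_univ m)
  calc ‖(k m).1‖ ≤ Cm * ‖mulL2 Ω (linWeight i τ) (k m).1‖ := hCm _
    _ ≤ Cm * (R * (N * (Cp * (Cg * ‖weightedSysOp Ω g c S k‖)))) :=
      mul_le_mul_of_nonneg_left (h4.trans (h3.trans (mul_le_mul_of_nonneg_left h2 hR.le))) hCm0.le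
    _ = _ := by ring

theorem exists_norm_lap_le_weightedSysOp (hΩo : IsOpen Ω) (hΩ : Bornology.IsBounded Ω) (i : Fin d)
    {g c : E d → ℝ} (hg : Continuous g) (hg0 : ∀ x, 0 < g x) (hc : Continuous c)
    (S : Matrix (Fin N) (Fin N) ℝ) :
    ∃ C, 0 ≤ C ∧ ∀ k : Fin N → Jet Ω, (∀ m, k m ∈ zeroJets Ω) →
      ∀ m, ‖Jet.lap (k m)‖ ≤ C * ‖weightedSysOp Ω g c S k‖ := by
  obtain ⟨Cc, hCc0, hCc⟩ := exists_bound_of_continuous hΩ hc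
  obtain ⟨Cg, hCg0, hCg⟩ := exists_norm_le_norm_mulL2 hΩo hΩ hg hg0
  obtain ⟨s, hs0, hs⟩ := exists_abs_le S
  obtain ⟨C, hC0, hC⟩ := exists_norm_val_le_weightedSysOp hΩo hΩ i hg hg0 hc S
  refine ⟨Cg + Cc * (s * (N * C)), by positivity, fun k hk m => ?_⟩
  -- the splitting of the Laplacian, with the trivial weight
  have h1 := norm_mulL2_lap_le hΩo hΩ (continuous_const (y := (1 : ℝ))) hc hCc0.le hCc hs k m
  simp only [mulL2_one hΩo hΩ] at h1
  have h2 := Finset.sum_le_sum fun n (_ : n ∈ Finset.univ) => hC k hk n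
  rw [Finset.sum_const, Finset.card_univ, Fintype.card_fin, nsmul_eq_mul] at h2
  have h3 := mul_le_mul_of_nonneg_left (mul_le_mul_of_nonneg_left h2 hs0) hCc0.le
  have h4 := norm_sysOp_le (c := c) hCg0 hCg S k m
  calc ‖Jet.lap (k m)‖ ≤ Cg * ‖weightedSysOp Ω g c S k‖ +
        Cc * (s * (N * (C * ‖weightedSysOp Ω g c S k‖))) := h1.trans (add_le_add h4 h3)
    _ = _ := by ring

theorem norm_jet_le (hΩo : IsOpen Ω) (hΩ : Bornology.IsBounded Ω) {k : Jet Ω}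
    (hk : k ∈ zeroJets Ω) : ‖k‖ ≤ ‖k.1‖ + ‖Jet.lap k‖ := by
  have h1 := norm_nonneg k.1
  have h2 := norm_nonneg (Jet.lap k)
  have h3 : 0 ≤ ‖k.1‖ + ‖Jet.lap k‖ := add_nonneg h1 h2
  refine norm_prod_le_iff.2 ⟨by linarith, norm_prod_le_iff.2
    ⟨(pi_norm_le_iff_of_nonneg h3).2 fun i => ?_, (pi_norm_le_iff_of_nonneg h3).2 fun i =>
      (pi_norm_le_iff_of_nonneg h3).2 fun j => ?_⟩⟩
  · have h := norm_grad_sq_le hΩo hΩ hk i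
    refine (sq_le_sq₀ (norm_nonneg _) h3).1 (h.trans ?_)
    nlinarith
  · have h := norm_hess_le hΩo hΩ hk i j
    linarith

/-- The weighted linear part of the residual is bounded below in the `H²` norm on the functions with
vanishing Cauchy data. -/
theorem exists_norm_le_weightedSysOp (hΩo : IsOpen Ω) (hΩ : Bornology.IsBounded Ω) (i : Fin d)
    {g c : E d → ℝ} (hg : Continuous g) (hg0 : ∀ x, 0 < g x) (hc : Continuous c)
    (S : Matrix (Fin N) (Fin N) ℝ) :
    ∃ C, 0 ≤ C ∧ ∀ k : Fin N → Jet Ω, (∀ m, k m ∈ zeroJets Ω) →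
      ‖k‖ ≤ C * ‖weightedSysOp Ω g c S k‖ := by
  obtain ⟨C₁, hC₁, h₁⟩ := exists_norm_val_le_weightedSysOp hΩo hΩ i hg hg0 hc S
  obtain ⟨C₂, hC₂, h₂⟩ := exists_norm_lap_le_weightedSysOp hΩo hΩ i hg hg0 hc S
  refine ⟨C₁ + C₂, by positivity, fun k hk => ?_⟩
  refine (pi_norm_le_iff_of_nonneg (by positivity)).2 fun m => ?_
  rw [add_mul]
  exact (norm_jet_le hΩo hΩ (hk m)).trans (add_le_add (h₁ k hk m) (h₂ k hk m))

/-! ### Existence and uniqueness of the minimizer -/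

/-- Pythagoras at the point `r` of `K` that is nearest to `-y`. -/
theorem exists_forall_norm_add_sq_eq {Y : Type*} [NormedAddCommGroup Y] [InnerProductSpace ℝ Y]
    (K : Submodule ℝ Y) [K.HasOrthogonalProjection] (y : Y) :
    ∃ r ∈ K, ∀ s ∈ K, ‖y + s‖ ^ 2 = ‖y + r‖ ^ 2 + ‖s - r‖ ^ 2 := by
  refine ⟨-K.starProjection y, K.neg_mem (K.starProjection_apply_mem y), fun s hs => ?_⟩
  have h1 : ⟪y - K.starProjection y, s - -K.starProjection y⟫_ℝ = 0 :=
    K.starProjection_inner_eq_zero y _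
      (K.sub_mem hs (K.neg_mem (K.starProjection_apply_mem y)))
  have h2 : y + s = (y - K.starProjection y) + (s - -K.starProjection y) := by abel
  rw [h2, ← sub_eq_add_neg, norm_add_sq_real, h1]
  ring

/-- For an operator `D` on a Banach space that is bounded below, the squared norm `‖y + D x‖²` has
exactly one minimizer: the range of `D` is closed, so that `-y` has a nearest point in it. -/
theorem exists_forall_norm_add_sq_le {X Y : Type*} [NormedAddCommGroup X] [NormedSpace ℝ X]
    [CompleteSpace X] [NormedAddCommGroup Y] [InnerProductSpace ℝ Y] [CompleteSpace Y]
    (D : X →L[ℝ] Y) {C : ℝ} (hC0 : 0 ≤ C) (hC : ∀ x, ‖x‖ ≤ C * ‖D x‖) (y : Y) :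
    ∃ x, ∀ x', ‖y + D x‖ ^ 2 ≤ ‖y + D x'‖ ^ 2 ∧ (‖y + D x'‖ ^ 2 ≤ ‖y + D x‖ ^ 2 → x' = x) := by
  have hD : AntilipschitzWith ⟨C, hC0⟩ D := D.antilipschitz_of_bound hC
  have hK : IsClosed (D.range : Set Y) := hD.isClosed_range D.uniformContinuous
  have : CompleteSpace D.range := hK.completeSpace_coe
  obtain ⟨r, ⟨x, hx⟩, hr⟩ := exists_forall_norm_add_sq_eq D.range y
  have hx' : D x = r := hx
  refine ⟨x, fun x' => ?_⟩
  rw [hx', hr (D x') ⟨x', rfl⟩]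
  refine ⟨le_add_of_nonneg_right (sq_nonneg _), fun h => hD.injective ?_⟩
  have h1 : ‖D x' - r‖ ^ 2 ≤ 0 := by linarith
  have h2 : D x' - r = 0 := by simpa using le_antisymm h1 (sq_nonneg _)
  rw [hx', sub_eq_zero.1 h2]

section Functional

variable {T : ℝ} {Ψ : ℕ → ℝ → ℝ} {c : E d → ℝ} {F : E d × ℝ × ℝ × E d → ℝ} {x₀ : E d}
  {b β lam : ℝ} {G Q : Fin N → E d → ℝ} {W : Fin N → H2 Ω}

theorem continuous_carlemanWeight (hβ : 0 < β) : Continuous (carlemanWeight x₀ b β lam) := by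
  unfold carlemanWeight
  exact Real.continuous_exp.comp (continuous_const.mul
    ((continuous_id.sub continuous_const).norm.rpow_const fun _ => Or.inr hβ.le))

theorem coeFn_lap_ae_eq (v : H2 Ω) : Jet.lap v.jet =ᵐ[volume.restrict Ω] v.laplacian := by
  rw [Jet.lap_apply]
  refine (Lp.coeFn_finsetSum _ _).trans (.of_forall fun x => ?_)
  simp [H2.laplacian, H2.jet]

/-- The functional is the squared distance, in the Hilbert space `L²(Ω)^N`, of an affine image of
`V` to the origin. -/
theorem J_eq_norm_sq (hΩo : IsOpen Ω) (hΩ : Bornology.IsBounded Ω) (hβ : 0 < β)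
    (hc : Continuous c) (hW : SourceMemL2 T Ψ F W) (V : Fin N → H2 Ω) :
    J T Ψ c F x₀ b β lam W V =
      ‖weightedSysOp Ω (fun x => √(carlemanWeight x₀ b β lam x)) c (matS N T Ψ) (fun m => (V m).jet)
        + WithLp.toLp 2 (fun m => mulL2 Ω (fun x => √(carlemanWeight x₀ b β lam x))
          ((hW m).toLp _))‖ ^ 2 := by
  set g : E d → ℝ := fun x => √(carlemanWeight x₀ b β lam x) with hg
  have hgc : Continuous g := (continuous_carlemanWeight hβ).sqrt
  have hgm := memLp_restrict_of_continuous hΩo hΩ hgc ⊤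
  have hcm := memLp_restrict_of_continuous hΩo hΩ hc ⊤
  rw [PiLp.norm_sq_eq_of_L2]
  set y : Fin N → L2 Ω := fun m =>
    mulL2 Ω g (sysOp Ω c (matS N T Ψ) m (fun m => (V m).jet) + (hW m).toLp _) with hy
  have hyi : ∀ m, Integrable (fun x => y m x ^ 2) (volume.restrict Ω) := fun m =>
    (Lp.memLp (y m)).integrable_sq
  have hyV : ∀ m, (weightedSysOp Ω g c (matS N T Ψ) (fun m => (V m).jet) +
      WithLp.toLp 2 (fun m => mulL2 Ω g ((hW m).toLp _))) m = y m := fun m => by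
    rw [PiLp.add_apply, weightedSysOp_apply, hy]
    simp only [map_add]
  simp only [hyV, norm_sq_eq_integral]
  rw [← integral_finsetSum _ fun m _ => hyi m, J]
  refine integral_congr_ae ?_
  have hres : ∀ m, ∀ᵐ x ∂(volume.restrict Ω), y m x ^ 2 =
      carlemanWeight x₀ b β lam x * residual T Ψ c F W V m x ^ 2 := fun m => by
    filter_upwards [coeFn_mulL2 hgm
        (sysOp Ω c (matS N T Ψ) m (fun m => (V m).jet) + (hW m).toLp _),
      Lp.coeFn_add (sysOp Ω c (matS N T Ψ) m (fun m => (V m).jet)) ((hW m).toLp _),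
      (hW m).coeFn_toLp, coeFn_lap_ae_eq (V m),
      Lp.coeFn_sub (Jet.lap (V m).jet) (mulL2 Ω c (∑ n, matS N T Ψ m n • (V n).val)),
      coeFn_mulL2 hcm (∑ n, matS N T Ψ m n • (V n).val),
      Lp.coeFn_finsetSum Finset.univ fun n => matS N T Ψ m n • (V n).val,
      ae_all_iff.2 fun n => Lp.coeFn_smul (matS N T Ψ m n) (V n).val] with x h1 h2 h3 h4 h5 h6 h7 h8
    have hsys : sysOp Ω c (matS N T Ψ) m (fun m => (V m).jet) =
      Jet.lap (V m).jet - mulL2 Ω c (∑ n, matS N T Ψ m n • (V n).val) := rfl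
    rw [hy]
    simp only
    rw [h1, h2, Pi.add_apply, hsys, h5, Pi.sub_apply, h4, h6, h7, h3, mul_pow, hg]
    simp only
    rw [Real.sq_sqrt (show 0 ≤ carlemanWeight x₀ b β lam x from (Real.exp_pos _).le)]
    simp only [residual, Matrix.mulVec, dotProduct, Finset.sum_apply, h8, Pi.smul_apply,
      smul_eq_mul]
  filter_upwards [ae_all_iff.2 hres] with x hx
  simp only [hx, Finset.mul_sum]

/-- The differences of admissible functions, as tuples of jets. -/
def zeroJetTuples (N : ℕ) (Ω : Set (E d)) : Submodule ℝ (Fin N → Jet Ω) :=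
  Submodule.pi univ fun _ => zeroJets Ω

theorem mem_zeroJetTuples {k : Fin N → Jet Ω} : k ∈ zeroJetTuples N Ω ↔ ∀ m, k m ∈ zeroJets Ω := by
  simp [zeroJetTuples, Submodule.mem_pi]

instance completeSpace_zeroJetTuples : CompleteSpace (zeroJetTuples N Ω) := by
  have h : IsClosed (zeroJetTuples N Ω : Set (Fin N → Jet Ω)) := by
    rw [zeroJetTuples, Submodule.coe_pi]
    exact isClosed_set_pi fun _ _ => isClosed_zeroJets
  exact h.completeSpace_coe

/-- Least squares for the weighted system: for every `y ∈ L²(Ω)^N` the norm of `y + D k` has exactly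
one minimizer among the tuples `k` with vanishing Cauchy data. -/
theorem exists_forall_norm_add_weightedSysOp_sq_le (hd : 1 ≤ d) (hΩo : IsOpen Ω)
    (hΩ : Bornology.IsBounded Ω) {g c : E d → ℝ} (hg : Continuous g) (hg0 : ∀ x, 0 < g x)
    (hc : Continuous c) (S : Matrix (Fin N) (Fin N) ℝ) (y : PiLp 2 (fun _ : Fin N => L2 Ω)) :
    ∃ k ∈ zeroJetTuples N Ω, ∀ l ∈ zeroJetTuples N Ω,
      ‖y + weightedSysOp Ω g c S k‖ ^ 2 ≤ ‖y + weightedSysOp Ω g c S l‖ ^ 2 ∧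
      (‖y + weightedSysOp Ω g c S l‖ ^ 2 ≤ ‖y + weightedSysOp Ω g c S k‖ ^ 2 → l = k) := by
  obtain ⟨C, hC0, hC⟩ := exists_norm_le_weightedSysOp hΩo hΩ ⟨0, hd⟩ hg hg0 hc S
  obtain ⟨k, hk⟩ := exists_forall_norm_add_sq_le
    ((weightedSysOp Ω g c S).domRestrict (zeroJetTuples N Ω)) hC0
    (fun k => hC k.1 (mem_zeroJetTuples.1 k.2)) y
  exact ⟨k.1, k.2, fun l hl => ⟨(hk ⟨l, hl⟩).1, fun h => congrArg Subtype.val ((hk ⟨l, hl⟩).2 h)⟩⟩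

theorem existsUnique_isMinimizer (hd : 1 ≤ d) (hΩo : IsOpen Ω) (hΩ : Bornology.IsBounded Ω)
    (hβ : 0 < β) (hc : Continuous c) (hH : (admissible Ω G Q).Nonempty)
    (hW : SourceMemL2 T Ψ F W) :
    ∃! V : Fin N → H2 Ω, IsMinimizer T Ψ c F x₀ b β lam G Q W V := by
  obtain ⟨V₀, hV₀⟩ := hH
  obtain ⟨D, hD⟩ : ∃ D, D = weightedSysOp Ω (fun x => √(carlemanWeight x₀ b β lam x)) c
    (matS N T Ψ) := ⟨_, rfl⟩
  obtain ⟨f, hf⟩ : ∃ f : PiLp 2 (fun _ : Fin N => L2 Ω), ∀ V, J T Ψ c F x₀ b β lam W V =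
      ‖D (fun m => (V m).jet) + f‖ ^ 2 :=
    ⟨_, fun V => by rw [hD]; exact J_eq_norm_sq hΩo hΩ hβ hc hW V⟩
  obtain ⟨k, hk, hmin⟩ := exists_forall_norm_add_weightedSysOp_sq_le hd hΩo hΩ
    (continuous_carlemanWeight hβ).sqrt (fun x => Real.sqrt_pos.2 (Real.exp_pos _)) hc (matS N T Ψ)
    (D (fun m => (V₀ m).jet) + f)
  rw [← hD] at hmin
  obtain ⟨V, hV, hVk⟩ := exists_admissible_jet_eq_add hΩo hΩ hV₀ (mem_zeroJetTuples.1 hk)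
  have hJ : ∀ V' : Fin N → H2 Ω, ∀ l : Fin N → Jet Ω, (∀ m, (V' m).jet = (V₀ m).jet + l m) →
      J T Ψ c F x₀ b β lam W V' = ‖D (fun m => (V₀ m).jet) + f + D l‖ ^ 2 := fun V' l hl => by
    have h1 : D (fun m => (V' m).jet) = D (fun m => (V₀ m).jet) + D l :=
      (congrArg D (funext hl)).trans (D.map_add (fun m => (V₀ m).jet) l)
    rw [hf, h1, add_right_comm]
  have hex : ∀ V' ∈ admissible Ω G Q, ∃ l ∈ zeroJetTuples N Ω,
      ∀ m, (V' m).jet = (V₀ m).jet + l m := fun V' hV' =>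
    ⟨fun m => (V' m).jet - (V₀ m).jet,
      mem_zeroJetTuples.2 (jet_sub_jet_mem_zeroJets hΩo hΩ hV' hV₀),
      fun m => (add_sub_cancel (V₀ m).jet (V' m).jet).symm⟩
  refine ⟨V, ⟨hV, fun V' hV' => ?_⟩, fun V' hV' => ?_⟩
  · obtain ⟨l, hl, hVl⟩ := hex V' hV'
    change J T Ψ c F x₀ b β lam W V ≤ J T Ψ c F x₀ b β lam W V'
    rw [hJ V k hVk, hJ V' l hVl]
    exact (hmin l hl).1
  · obtain ⟨l, hl, hVl⟩ := hex V' hV'.1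
    have h1 : J T Ψ c F x₀ b β lam W V' ≤ J T Ψ c F x₀ b β lam W V := hV'.2 hV
    rw [hJ V k hVk, hJ V' l hVl] at h1
    have h2 := (hmin l hl).2 h1
    refine funext fun m => H2.jet_injective ?_
    rw [hVl, hVk, h2]

end Functional

/-- A recursion in which every step has exactly one solution has exactly one solution. -/
theorem existsUnique_seq {X : Type*} {P : X → Prop} {R : X → X → Prop}
    (h : ∀ x, P x → ∃! y, R x y) (hP : ∀ x y, R x y → P y) {x₀ : X} (hx₀ : P x₀) :
    ∃! u : ℕ → X, u 0 = x₀ ∧ ∀ k, 1 ≤ k → R (u (k - 1)) (u k) := by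
  choose! f hf hfu using h
  have key : ∀ k, P (f^[k] x₀) := fun k => by
    induction k with
    | zero => exact hx₀
    | succ k ih =>
      rw [Function.iterate_succ_apply']
      exact hP _ _ (hf _ ih)
  refine ⟨fun k => f^[k] x₀, ⟨rfl, fun k hk => ?_⟩, fun u hu => funext fun k => ?_⟩
  · obtain ⟨k, rfl⟩ := Nat.exists_eq_add_of_le' hk
    simp only [Nat.add_sub_cancel, Function.iterate_succ_apply']
    exact hf _ (key k)
  · induction k with
    | zero => exact hu.1
    | succ k ih =>
      have h1 := hu.2 (k + 1) (by omega)
      rw [Nat.add_sub_cancel, ih] at h1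
      simp only [Function.iterate_succ_apply']
      exact hfu _ (key k) _ h1

end CarlemanLS
end

theorem theorem4p1 {d N : ℕ} (hd : 1 ≤ d)
    -- the bounded smooth domain
    (Ω : Set (E d)) (hΩo : IsOpen Ω) (hΩc : IsConnected Ω) (hΩb : Bornology.IsBounded Ω)
    (hΩs : HasSmoothBoundary Ω)
    -- the time interval and the basis
    (T : ℝ) (hT : 0 < T) (Ψ : ℕ → ℝ → ℝ) (hΨ : IsC1OrthonormalBasis T Ψ)
    -- the coefficient and the nonlinearity
    (c : E d → ℝ) (hc : ContDiff ℝ 1 c) (c₀ : ℝ) (hc₀ : 0 < c₀) (hcc₀ : ∀ x, c₀ ≤ c x)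
    (F : E d × ℝ × ℝ × E d → ℝ) (hF : ContDiff ℝ 1 F)
    -- the Carleman weight
    (x₀ : E d) (hx₀ : x₀ ∉ closure Ω) (hr : ∀ x ∈ Ω, 1 < ‖x - x₀‖)
    (b : ℝ) (hb : ∀ x ∈ closure Ω, ‖x - x₀‖ < b)
    (β lam : ℝ) (hβ : 0 < β) (hlam : 0 < lam)
    -- the Cauchy data
    (G Q : Fin N → E d → ℝ) (hH : (admissible Ω G Q).Nonempty) :
    (∀ (U : ℕ → Fin N → H2 Ω) (k : ℕ), 1 ≤ k → SourceMemL2 T Ψ F (U (k - 1)) →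
      ∃! V : Fin N → H2 Ω, IsMinimizer T Ψ c F x₀ b β lam G Q (U (k - 1)) V) ∧
    (∀ U₀ : Fin N → H2 Ω, SourceMemL2 T Ψ F U₀ →
      (∀ W ∈ admissible Ω G Q, SourceMemL2 T Ψ F W) →
      ∃! U : ℕ → Fin N → H2 Ω, U 0 = U₀ ∧
        ∀ k, 1 ≤ k → IsMinimizer T Ψ c F x₀ b β lam G Q (U (k - 1)) (U k)) := by
  refine ⟨fun U k _ hU => existsUnique_isMinimizer hd hΩo hΩb hβ hc.continuous hH hU,
    fun U₀ hU₀ hadm => ?_⟩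
  exact existsUnique_seq (P := fun W => SourceMemL2 T Ψ F W)
    (fun W hW => existsUnique_isMinimizer hd hΩo hΩb hβ hc.continuous hH hW)
    (fun _ V hV => hadm V hV.1) hU₀
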